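/- \textbf{Model.} In the Congested Clique on $V=\{1,\dots,n\}$, $n\ge 2$, computation proceeds in synchronous rounds; in each round every vertex sends a message of $\lceil\log_2 n\rceil$ bits to every vertex (possibly different messages to different vertices), and local computation is unrestricted. Algorithms are deterministic. \textbf{Exponent.} Let $\sigma\ge 2$ be such that, over the field $\mathbb F$, for every $d\ge1$ two $d\times d$ matrices can be multiplied by a bilinear algorithm with at most $C d^{\sigma}$ multiplications, and put $\rho=1-2/\sigma$, the resulting exponent of matrix multiplication in the Congested Clique. The field $\mathbb F$ is finite with $|\mathbb F|\le n^{\kappa}$, so that its elements are represented by $O(\log n)$ bits. \textbf{$p$-balanced families.} A family $\mathcal U=(U_1,\dots,U_r)$ of subsets of $V$ with $r=p^{-a}$ is $p$-balanced if $0\le a\le 2$; $n^{-1/2}\le p\le 1$; every vertex belongs to at most $\lceil rp\rceil\cdot 4\log_2 n$ of the sets; and $|U_i|\le\lceil 4np\rceil$ for all $i$. \textbf{Blocks and labels.} Let $m=\lfloor\sqrt{n/r}\rfloor=\lfloor\sqrt{np^{a}}\rfloor$. Each label $(x,y,i)\in[m]\times[m]\times[r]$ is given to exactly one vertex (if $n=m^2r$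 this labels all the vertices bijectively). For a $k\times k$ matrix $A$ let $t=\lceil\sqrt{k/m}\,\rceil$ and write each of its $k$ indices as $v=v_1v_2v_3$ (most significant digit first) with $v_1,v_3\in[t]$ and $v_2\in[m]$; then $A[*x*,*y*]$ is the submatrix of $A$ formed by the rows with $v_2=x$ and the columns with $v_2=y$. \textbf{Corollary.} For all $C,\sigma,\kappa$ and $c$ there is a constant $K$ such that the following holds for all $n,r,p,a,\mathbb F$ as above and every integer $0\le h\le n^{c}$ (in particular, for every constant $h\ge 0$). There is a Congested Clique algorithm that runs for at most $$K\left(\log_2 (h)\cdot n^{\rho}\cdot p^{2+a(\rho-1)}+\log_2 n\right)$$ rounds (where $\log_2(0)$ is read as $0$) and does the following for every (directed or undirected) graph $G$ on $V$, every $p$-balanced family $\mathcal U=(U_1,\dots,U_r)$ and every such labelling. Initially each vertex knows only its (out-)neighbours in $G$, the indices $j$ with $v\in U_j$, and its own label, beside the common parameters $n,r,p,a,h,\mathbb F$. Let $A_i$ be the adjacency matrix over $\mathbb F$ of the induced subgraph $G[U_i]$, with rows and columns in the increasing order of the vertices in $U_i$. At the end, in parallel, every vertex with a label $(x,y,i)$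 knows the block $(A_i)^h[*x*,*y*]$, including which vertices of $U_i$ index its rows and columns. -/

import Mathlib

/-! ### The Congested Clique model -/

/-- A message: a string of `⌈log₂ n⌉` bits. -/
abbrev Word (n : ℕ) : Type := Fin (Nat.clog 2 n) → Bool

/-- A deterministic algorithm for the Congested Clique on the vertex set `Fin n`, where a vertex has
a local input in `I` and a local output in `O`. Local computation is unrestricted. In each
synchronous round every vertex sends one word to each vertex (possibly a different word to each)
and then updates its state from its old state and the `n` words that it received. -/
structure CongestedClique (n : ℕ) (I O : Type) where
  State : Type
  init : Fin n → I → State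
  send : Fin n → State → Fin n → Word n
  update : Fin n → State → (Fin n → Word n) → State
  out : Fin n → State → O

namespace CongestedClique

variable {n : ℕ} {I O : Type}

/-- The state of each vertex after a number of rounds. -/
def stateAfter (alg : CongestedClique n I O) (inp : Fin n → I) : ℕ → Fin n → alg.State
  | 0, v => alg.init v (inp v)
  | t + 1, v =>
      alg.update v (alg.stateAfter inp t v) fun u => alg.send u (alg.stateAfter inp t u) v

/-- The output of vertex `v` when the algorithm is stopped after `T` rounds. -/
def output (alg : CongestedClique n I O) (inp : Fin n → I) (T : ℕ) (v : Fin n) : O :=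
  alg.out v (alg.stateAfter inp T v)

end CongestedClique

/-! ### The exponent of matrix multiplication -/

/-- Over `F` there is a bilinear algorithm that multiplies two `d × d` matrices with `m`
multiplications. -/
def HasBilinearAlgorithm (F : Type) [Field F] (d m : ℕ) : Prop :=
  ∃ α β γ : Fin d → Fin d → Fin m → F, ∀ (S T : Matrix (Fin d) (Fin d) F) (i j : Fin d),
    (S * T) i j =
      ∑ w, γ i j w * ((∑ k, ∑ l, α k l w * S k l) * ∑ k, ∑ l, β k l w * T k l)

/-- Over `F`, two `d × d` matrices can be multiplied by a bilinear algorithm with at most `C d ^ σ`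
multiplications, for every `d ≥ 1`. -/
def HasMultiplicationExponent (F : Type) [Field F] (C σ : ℝ) : Prop :=
  ∀ d : ℕ, 1 ≤ d → ∃ m : ℕ, (m : ℝ) ≤ C * (d : ℝ) ^ σ ∧ HasBilinearAlgorithm F d m

/-! ### `p`-balanced families -/

/-- The conditions on the parameters of a `p`-balanced family of `r = p ^ (-a)` sets. -/
structure BalancedParameters (n r : ℕ) (p a : ℝ) : Prop where
  card_eq : (r : ℝ) = p ^ (-a)
  a_nonneg : 0 ≤ a
  a_le_two : a ≤ 2
  le_p : (n : ℝ) ^ (-(1 / 2) : ℝ) ≤ p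
  p_le_one : p ≤ 1

/-- The family `U` of `r = p ^ (-a)` sets of vertices is `p`-balanced. -/
structure IsBalanced {n r : ℕ} (p a : ℝ) (U : Fin r → Finset (Fin n)) : Prop
    extends BalancedParameters n r p a where
  membership_le : ∀ v : Fin n,
    ((Finset.univ.filter fun i => v ∈ U i).card : ℝ) ≤ (⌈(r : ℝ) * p⌉₊ : ℝ) * 4 * Real.logb 2 n
  card_le : ∀ i : Fin r, (U i).card ≤ ⌈4 * (n : ℝ) * p⌉₊

/-! ### Adjacency matrices and their blocks -/

open Classical in
/-- The adjacency matrix over `F` of the induced subgraph `G[W]`. -/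
noncomputable def inducedAdjMatrix (F : Type) [Field F] {n : ℕ} (G : Digraph (Fin n))
    (W : Finset (Fin n)) : Matrix W W F :=
  Matrix.of fun u w => if G.Adj u w then 1 else 0

/-- The number of values of the outer digits `v₁`, `v₃` when the indices below `k` are written as
`v = v₁ v₂ v₃` with `v₂` below `m`: the least `t` with `k ≤ m t²`, that is `⌈√(k / m)⌉`. -/
noncomputable def outerSize (k m : ℕ) : ℕ := sInf {t : ℕ | k ≤ m * t ^ 2}

/-- The middle digit `v₂` of the index `v = v₁ v₂ v₃ = v₁ (m t) + v₂ t + v₃` below `k`, where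
`v₁, v₃ < t = outerSize k m` and `v₂ < m`. -/
noncomputable def middleDigit (k m v : ℕ) : ℕ := v / outerSize k m % m

/-- The row and column index (counted from `0`) of the vertex `u` in a matrix whose rows and columns
are indexed by the vertices of `W` in increasing order. -/
def position {n : ℕ} (W : Finset (Fin n)) (u : Fin n) : ℕ := (W.filter (· < u)).card

/-- The condition that the row (or column) of `u` belongs to the part `*x*` of `W`. -/
def InPart {n : ℕ} (W : Finset (Fin n)) (m x : ℕ) (u : Fin n) : Prop :=
  u ∈ W ∧ middleDigit W.card m (position W u) = x

open Classical in
/-- The block `A[*x*,*y*]`, as a partial matrix: the entry at `(u, w)` if `u` lies in `*x*` and `w`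
lies in `*y*`, and `none` at all other places. -/
noncomputable def block {F : Type} {n : ℕ} {W : Finset (Fin n)} (A : Matrix W W F) (m x y : ℕ)
    (u w : Fin n) : Option F :=
  if h : InPart W m x u ∧ InPart W m y w then some (A ⟨u, h.1.1⟩ ⟨w, h.2.1⟩) else none

/-! ### Labels and local inputs -/

/-- `⌊√(n / r)⌋`, which is `⌊√(n p ^ a)⌋` if `r = p ^ (-a)`. -/
def gridSize (n r : ℕ) : ℕ := Nat.sqrt (n / r)

/-- Labels `(x, y, i)`. -/
abbrev Label (n r : ℕ) : Type := Fin (gridSize n r) × Fin (gridSize n r) × Fin r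

/-- Each label is given to exactly one vertex. (If `n / r` is a perfect square, then there are `n`
labels, so that `ℓ` is a bijection from the vertices to the labels; in general there may be
vertices without a label.) -/
def IsLabelling {n r : ℕ} (ℓ : Fin n → Option (Label n r)) : Prop :=
  ∀ L : Label n r, ∃! v, ℓ v = some L

/-- What a vertex knows at the start, beside the parameters that are known to all vertices: its
(out-)neighbours, the sets of the family to which it belongs, and its own label. -/
structure LocalInput (n r : ℕ) where
  neighbours : Set (Fin n)
  memberOf : Set (Fin r)
  label : Option (Label n r)

/-- The local input of `v`. -/
def localInput {n r : ℕ} (G : Digraph (Fin n)) (U : Fin r → Finset (Fin n))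
    (ℓ : Fin n → Option (Label n r)) (v : Fin n) : LocalInput n r where
  neighbours := {w | G.Adj v w}
  memberOf := {i | v ∈ U i}
  label := ℓ v

/-! ### Knowledge that is reachable within a number of rounds -/

/-! Local computation is unrestricted, so a vertex can compute exactly those values that coincide in
any two instances which it cannot tell apart. Algorithms are therefore built from a few
communication primitives, and all local work is replaced by proofs of such coincidences
(`Determines`, `HoldsAt`, `KnowsFamily`, `KnowsBlocks`).

Communication rests on deterministic routing (`Solves.route`): if every vertex sends and receives at
most `L n` messages of `O(log n)` bits, then `O(L + 1)` rounds suffice. The vertices simulate an `s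
× s` network with `s = ⌈√n⌉`, and messages of equal kind are repeatedly dealt out round-robin, so
that no link is overloaded.

The `m²` owners of the labels `(x, y, i)` multiply the `i`-th matrices, whose size is at most `k =
⌈4np⌉`. Each index is split into a high digit below `d` and a low digit below `q`, with `k ≤ d q`.
The matrix becomes a `d × d` matrix of `q × q` matrices, and a bilinear algorithm reduces the
product to `M ≤ C d ^ σ` products of `q × q` matrices, shared by the workers of the group. With `d =
⌊m ^ (2 / σ)⌋` there are `O(1)` products per worker, and the load is `O(q² + n)`. Here `q²` is about
`(np)² / m ^ (4 / σ)`, and `m²` is about `n p ^ a`, which gives `n · n ^ ρ p ^ (2 + a(ρ - 1))`.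
Dividing by `n` gives the cost of one multiplication, up to an additive constant
(`KnowsBlocks.exists_mul`, `BalancedParameters.ceil_sq_le_mul_dimension`); repeated squaring gives
the factor `log h`.

Since `a ≤ 2`, `r p² ≤ 1`. Hence a block has only `O(n)` entries, and a vertex has to report `O(n
log n)` adjacency bits at the start, which is the source of the term `log n`. The bound `h ≤ n ^ c`
lets this term absorb the additive constant of each of the `O(log h)` multiplications. -/

/-- From the knowledge `inp ω v` of every vertex `v` in the instance `ω`, some algorithm reaches the
knowledge `out ω v` within `T` rounds. -/
def Solves {n : ℕ} {Ω I O : Type} (inp : Ω → Fin n → I) (out : Ω → Fin n → O) (T : ℕ) : Prop :=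
  ∃ alg : CongestedClique n I O, ∀ ω v, alg.output (inp ω) T v = out ω v

/-- The local value `out ω v` is a function of `v` and the local value `inp ω v`. -/
def Determines {Ω V I O : Type} (inp : Ω → V → I) (out : Ω → V → O) : Prop :=
  ∀ ω ω' v, inp ω v = inp ω' v → out ω v = out ω' v

theorem Determines.exists_eq {Ω V I O : Type} [Nonempty O] {inp : Ω → V → I} {out : Ω → V → O}
    (h : Determines inp out) : ∃ g : V → I → O, ∀ ω v, out ω v = g v (inp ω v) := by
  classical
  -- Any instance with the given local knowledge serves to read off the value; knowledge that never
  -- occurs gets an arbitrary value.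
  refine ⟨fun v i => if h : ∃ ω, inp ω v = i then out h.choose v else Classical.arbitrary O, ?_⟩
  intro ω v
  have hex : ∃ ω', inp ω' v = inp ω v := ⟨ω, rfl⟩
  simp only [dif_pos hex]
  exact (h _ _ v hex.choose_spec).symm

namespace Solves

variable {n : ℕ} {Ω I J O : Type} {inp : Ω → Fin n → I} {mid : Ω → Fin n → J}
  {out : Ω → Fin n → O}

theorem of_determines [Nonempty O] (h : Determines inp out) : Solves inp out 0 := by
  obtain ⟨g, hg⟩ := h.exists_eq
  exact ⟨⟨I, fun _ i => i, fun _ _ _ _ => false, fun _ s _ => s, g⟩, fun ω v => (hg ω v).symm⟩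

theorem comp {T₁ T₂ : ℕ} (h₁ : Solves inp mid T₁) (h₂ : Solves mid out T₂) :
    Solves inp out (T₁ + T₂) := by
  obtain ⟨A, hA⟩ := h₁
  obtain ⟨B, hB⟩ := h₂
  -- The state of the first algorithm carries a round counter. The switch to the second one is
  -- tested right after each update, and also at time `0`, so no round is lost even if `T₁ = 0`.
  let conv : Fin n → ℕ → A.State → (ℕ × A.State) ⊕ B.State := fun v t s =>
    if t = T₁ then Sum.inr (B.init v (A.out v s)) else Sum.inl (t, s)
  let D : CongestedClique n I O :=
    { State := ((ℕ × A.State) ⊕ B.State)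
      init := fun v i => conv v 0 (A.init v i)
      send := fun v s u => match s with
        | Sum.inl (_, s) => A.send v s u
        | Sum.inr s => B.send v s u
      update := fun v s w => match s with
        | Sum.inl (t, s) => conv v (t + 1) (A.update v s w)
        | Sum.inr s => Sum.inr (B.update v s w)
      out := fun v s => match s with
        | Sum.inl (_, s) => B.out v (B.init v (A.out v s))
        | Sum.inr s => B.out v s }
  have e₁ : ∀ ω t, t ≤ T₁ → ∀ v, D.stateAfter (inp ω) t v = conv v t (A.stateAfter (inp ω) t v) := by
    intro ω t
    induction t with
    | zero => intro _ v; rfl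
    | succ t ih =>
      intro ht v
      have hne : t ≠ T₁ := by omega
      have ih' := ih (by omega)
      simp only [CongestedClique.stateAfter, ih', conv, if_neg hne, D]
  have e₂ : ∀ ω t v, D.stateAfter (inp ω) (T₁ + t) v = Sum.inr (B.stateAfter (mid ω) t v) := by
    intro ω t
    induction t with
    | zero =>
      intro v
      have := hA ω v
      simp only [CongestedClique.output] at this
      rw [Nat.add_zero, e₁ ω T₁ le_rfl v]
      simp only [conv, if_true, CongestedClique.stateAfter, this]
    | succ t ih =>
      intro v
      rw [← Nat.add_assoc]
      simp only [CongestedClique.stateAfter, ih, D]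
  refine ⟨D, fun ω v => ?_⟩
  rw [CongestedClique.output, e₂, ← hB ω v]
  rfl

theorem idle (inp : Ω → Fin n → I) (T : ℕ) : Solves inp inp T := by
  refine ⟨⟨I, fun _ i => i, fun _ _ _ _ => false, fun _ s _ => s, fun _ s => s⟩, fun ω v => ?_⟩
  change CongestedClique.stateAfter _ _ T v = _
  induction T with
  | zero => rfl
  | succ T ih => simpa only [CongestedClique.stateAfter] using ih

theorem mono {T T' : ℕ} (h : Solves inp out T) (hT : T ≤ T') : Solves inp out T' := by
  obtain ⟨k, rfl⟩ := Nat.exists_eq_add_of_le hT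
  exact h.comp (idle out k)

theorem weaken [Nonempty O] {T : ℕ} (h : Solves inp mid T) (hd : Determines mid out) :
    Solves inp out T := h.comp (of_determines hd)

theorem keep {T : ℕ} (h : Solves inp out T) : Solves inp (fun ω v => (inp ω v, out ω v)) T := by
  obtain ⟨A, hA⟩ := h
  let D : CongestedClique n I (I × O) :=
    { State := I × A.State
      init := fun v i => (i, A.init v i)
      send := fun v s u => A.send v s.2 u
      update := fun v s w => (s.1, A.update v s.2 w)
      out := fun v s => (s.1, A.out v s.2) }
  have e : ∀ ω t v, D.stateAfter (inp ω) t v = (inp ω v, A.stateAfter (inp ω) t v) := by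
    intro ω t
    induction t with
    | zero => intro v; rfl
    | succ t ih => intro v; simp only [CongestedClique.stateAfter, ih, D]
  refine ⟨D, fun ω v => ?_⟩
  rw [CongestedClique.output, e]
  exact Prod.ext rfl (hA ω v)

/-- An algorithm may be chosen by the value of a parameter that every vertex knows. -/
theorem cases {P : Type} [Nonempty P] {T : ℕ} (π : Ω → P)
    (hπ : Determines inp fun ω _ => π ω)
    (h : ∀ q, Solves (fun ω : {ω // π ω = q} => inp ω) (fun ω => out ω) T) :
    Solves inp out T := by
  obtain ⟨g, hg⟩ := hπ.exists_eq
  choose A hA using h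
  let D : CongestedClique n I O :=
    { State := Σ q, (A q).State
      init := fun v i => ⟨g v i, (A (g v i)).init v i⟩
      send := fun v s u => (A s.1).send v s.2 u
      update := fun v s w => ⟨s.1, (A s.1).update v s.2 w⟩
      out := fun v s => (A s.1).out v s.2 }
  have e : ∀ ω t v, D.stateAfter (inp ω) t v = ⟨π ω, (A (π ω)).stateAfter (inp ω) t v⟩ := by
    intro ω t
    induction t with
    | zero =>
      intro v
      simp only [CongestedClique.stateAfter, D]
      rw [← hg ω v]
    | succ t ih =>
      intro v
      change D.update v (D.stateAfter (inp ω) t v)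
        (fun u => D.send u (D.stateAfter (inp ω) t u) v) = _
      simp only [ih]
      rfl
  refine ⟨D, fun ω v => ?_⟩
  rw [CongestedClique.output, e]
  exact hA (π ω) ⟨ω, rfl⟩ v

theorem round (word : Ω → Fin n → Fin n → Word n) (hw : Determines inp word) :
    Solves inp (fun ω v => (inp ω v, fun u => word ω u v)) 1 := by
  obtain ⟨g, hg⟩ := hw.exists_eq
  refine ⟨⟨I × (Fin n → Word n), fun _ i => (i, fun _ _ => false), fun v s => g v s.1,
    fun _ s w => (s.1, w), fun _ s => s⟩, fun ω v => ?_⟩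
  simp only [CongestedClique.output, CongestedClique.stateAfter, ← hg]

theorem rounds [Nonempty I] (T : ℕ) (word : Ω → Fin n → Fin n → Fin T → Word n)
    (hw : Determines inp word) :
    Solves inp (fun ω v => (inp ω v, fun u => word ω u v)) T := by
  induction T with
  | zero =>
    refine of_determines fun ω ω' v h => Prod.ext h ?_
    funext u j
    exact j.elim0
  | succ T ih =>
    have h₁ := ih (fun ω u v j => word ω u v j.castSucc)
      fun ω ω' v h => by simp only [hw ω ω' v h]
    have h₂ := round (inp := fun ω v => (inp ω v, fun u (j : Fin T) => word ω u v j.castSucc))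
      (fun ω u v => word ω u v (Fin.last T)) fun ω ω' v h => by
        simp only [hw ω ω' v (Prod.ext_iff.1 h).1]
    refine (h₁.comp h₂).weaken fun ω ω' v h => ?_
    simp only [Prod.mk.injEq] at h ⊢
    refine ⟨h.1.1, ?_⟩
    funext u j
    refine Fin.lastCases ?_ (fun j => ?_) j
    · exact congrFun h.2 u
    · exact congrFun (congrFun h.1.2 u) j

/-- Every vertex sends a message to every vertex. -/
theorem exchange [Nonempty I] {W : Type} [Finite W] [Nonempty W] (T : ℕ)
    (hcard : Nat.card W ≤ 2 ^ (T * Nat.clog 2 n)) (msg : Ω → Fin n → Fin n → W)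
    (hm : Determines inp msg) :
    Solves inp (fun ω v => (inp ω v, fun u => msg ω u v)) T := by
  classical
  have := Fintype.ofFinite W
  have hle : Fintype.card W ≤ Fintype.card (Fin T → Word n) := by
    simp only [Fintype.card_fun, Fintype.card_fin, Fintype.card_bool]
    rw [← pow_mul, mul_comm, ← Nat.card_eq_fintype_card]
    exact hcard
  obtain ⟨f⟩ := Function.Embedding.nonempty_of_card_le hle
  have h := rounds (inp := inp) T (fun ω u v => f (msg ω u v))
    fun ω ω' v h => by simp only [hm ω ω' v h]
  refine h.weaken fun ω ω' v h => ?_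
  simp only [Prod.mk.injEq] at h ⊢
  exact ⟨h.1, funext fun u => f.injective (congrFun h.2 u)⟩

end Solves

/-! ### Round-robin distribution -/

theorem ncard_sep_mem_eq_sum {E K : Type} [Finite E] (A : Set E) (φ : E → K) (K₀ : Finset K) :
    {e | e ∈ A ∧ φ e ∈ K₀}.ncard = ∑ k ∈ K₀, {e | e ∈ A ∧ φ e = k}.ncard := by
  classical
  have := Fintype.ofFinite E
  simp only [Set.ncard_eq_toFinset_card', Set.toFinset_ofPred]
  rw [Finset.card_eq_sum_card_fiberwise (f := φ) (t := K₀)]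
  · refine Finset.sum_congr rfl fun k hk => ?_
    congr 1
    ext e
    simp only [Finset.mem_filter, Finset.mem_univ, true_and]
    constructor
    · rintro ⟨⟨h₁, -⟩, h₂⟩
      exact ⟨h₁, h₂⟩
    · rintro ⟨h₁, rfl⟩
      exact ⟨⟨h₁, hk⟩, rfl⟩
  · intro e he
    simpa using (Finset.mem_filter.1 he).2.2

/-- Number the elements of `Z` and reduce the numbers modulo `s`: every residue occurs at most `|Z|
/ s + 1` times. -/
theorem exists_roundRobin {E : Type} [Finite E] (s : ℕ) [NeZero s] (Z : Set E) :
    ∃ f : E → Fin s, ∀ j, s * {e | e ∈ Z ∧ f e = j}.ncard ≤ Z.ncard + s := by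
  classical
  have hs : 0 < s := Nat.pos_of_ne_zero (NeZero.ne s)
  obtain ⟨g, hg⟩ : ∃ g : E → ℕ, Set.InjOn g Z ∧ ∀ e ∈ Z, g e < Z.ncard := by
    have eqv := Finite.equivFin Z
    refine ⟨fun e => if h : e ∈ Z then eqv ⟨e, h⟩ else 0, ?_, ?_⟩
    · intro a ha b hb hab
      simp only [dif_pos ha, dif_pos hb] at hab
      simpa using eqv.injective (Fin.ext hab)
    · intro e he
      simp only [dif_pos he]
      exact (eqv ⟨e, he⟩).2
  refine ⟨fun e => ⟨g e % s, Nat.mod_lt _ hs⟩, fun j => ?_⟩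
  have hle : {e | e ∈ Z ∧ (⟨g e % s, Nat.mod_lt _ hs⟩ : Fin s) = j}.ncard
      ≤ (Finset.range (Z.ncard / s + 1) : Set ℕ).ncard := by
    refine Set.ncard_le_ncard_of_injOn (fun e => g e / s) ?_ ?_ (Finset.finite_toSet _)
    · rintro e ⟨he, -⟩
      simp only [Finset.coe_range, Set.mem_Iio]
      exact Nat.lt_succ_of_le (Nat.div_le_div_right (hg.2 e he).le)
    · rintro a ⟨ha, ha'⟩ b ⟨hb, hb'⟩ hab
      refine hg.1 ha hb ?_
      have h₁ : g a % s = g b % s := by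
        rw [← hb'] at ha'
        exact Fin.mk.inj_iff.1 ha'
      rw [← Nat.div_add_mod (g a) s, ← Nat.div_add_mod (g b) s, h₁]
      simp only at hab
      rw [hab]
  rw [Set.ncard_coe_finset, Finset.card_range] at hle
  calc _ ≤ s * (Z.ncard / s + 1) := Nat.mul_le_mul_left _ hle
    _ ≤ Z.ncard + s := by
      have := Nat.mul_div_le Z.ncard s
      rw [Nat.mul_add, Nat.mul_one]
      omega

/-- The elements of `A` in each fibre of `φ` are distributed evenly to the `s` values. -/
noncomputable def spread {E K : Type} [Finite E] (s : ℕ) [NeZero s] (A : Set E) (φ : E → K) (e : E) :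
    Fin s :=
  (exists_roundRobin s {e' | e' ∈ A ∧ φ e' = φ e}).choose e

/-- Each fibre is dealt out separately and exceeds its fair share by at most one element per value,
so the total excess is the number of fibres. -/
theorem spread_ncard_le {E K : Type} [Finite E] (s : ℕ) [NeZero s] (A : Set E) (φ : E → K)
    (K₀ : Finset K) (j : Fin s) :
    s * {e | e ∈ A ∧ φ e ∈ K₀ ∧ spread s A φ e = j}.ncard
      ≤ {e | e ∈ A ∧ φ e ∈ K₀}.ncard + s * K₀.card := by
  have h₁ := ncard_sep_mem_eq_sum {e | e ∈ A ∧ spread s A φ e = j} φ K₀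
  have h₂ : {e | e ∈ A ∧ φ e ∈ K₀ ∧ spread s A φ e = j}
      = {e | e ∈ {e | e ∈ A ∧ spread s A φ e = j} ∧ φ e ∈ K₀} := by
    ext e; simp only [Set.mem_ofPred_eq]; tauto
  rw [h₂, h₁, ncard_sep_mem_eq_sum A φ K₀, Finset.mul_sum, mul_comm s K₀.card, ← smul_eq_mul (K₀.card),
    ← Finset.sum_const, ← Finset.sum_add_distrib]
  refine Finset.sum_le_sum fun k _ => ?_
  refine le_trans (Nat.mul_le_mul_left _ (Set.ncard_le_ncard ?_))
    ((exists_roundRobin s {e' | e' ∈ A ∧ φ e' = k}).choose_spec j)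
  rintro e ⟨⟨he, hj⟩, rfl⟩
  exact ⟨⟨he, rfl⟩, hj⟩

/-- The form in which balancing is used: `c` is the fair share and `k`, a bound on the number of
fibres involved, is the price of rounding. -/
theorem ncard_mul_le {E K : Type} [Finite E] {A B : Set E} {φ : E → K} {s : ℕ} [NeZero s]
    {j : Fin s} (K₀ : Finset K) (c k : ℕ) (hK : K₀.card ≤ k)
    (hB : ∀ e ∈ B, e ∈ A ∧ φ e ∈ K₀ ∧ spread s A φ e = j)
    (hc : {e | e ∈ A ∧ φ e ∈ K₀}.ncard ≤ c * s) : B.ncard ≤ c + k := by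
  have hs : 0 < s := Nat.pos_of_ne_zero (NeZero.ne s)
  refine Nat.le_of_mul_le_mul_left ?_ hs
  calc s * B.ncard ≤ _ := Nat.mul_le_mul_left _ (Set.ncard_le_ncard fun e he => hB e he)
    _ ≤ _ := spread_ncard_le s A φ K₀ j
    _ ≤ c * s + s * k := Nat.add_le_add hc (Nat.mul_le_mul_left _ hK)
    _ = s * (c + k) := by ring

/-! ### Moving messages between the nodes of a virtual network -/

section Held

variable {Ω E V X Y Z : Type}

/-- The messages that are held by the node `a`, with the information `inf` attached to them. -/
def Held (A : Ω → Set E) (loc : Ω → E → V) (inf : Ω → E → X) (ω : Ω) (a : V) : Set (E × X) :=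
  {p | p.1 ∈ A ω ∧ loc ω p.1 = a ∧ inf ω p.1 = p.2}

/-- A datum of the messages that is known at the places where they are. -/
def LocallyKnown (A : Ω → Set E) (loc : Ω → E → V) (inf : Ω → E → X) (f : Ω → E → Y) : Prop :=
  ∀ ω ω' a, Held A loc inf ω a = Held A loc inf ω' a → ∀ e ∈ A ω, loc ω e = a → f ω e = f ω' e

variable {A : Ω → Set E} {loc : Ω → E → V} {inf : Ω → E → X}

theorem Held.mem_of_eq {ω ω' : Ω} {a : V} (h : Held A loc inf ω a = Held A loc inf ω' a) {e : E}
    (he : e ∈ A ω) (ha : loc ω e = a) : e ∈ A ω' ∧ loc ω' e = a ∧ inf ω' e = inf ω e := by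
  have : (e, inf ω e) ∈ Held A loc inf ω' a := h ▸ ⟨he, ha, rfl⟩
  exact this

theorem LocallyKnown.of_inf : LocallyKnown A loc inf inf :=
  fun _ _ _ h _ he ha => (Held.mem_of_eq h he ha).2.2.symm

theorem LocallyKnown.of_loc : LocallyKnown A loc inf loc :=
  fun _ _ _ h _ he ha => ha.trans (Held.mem_of_eq h he ha).2.1.symm

theorem LocallyKnown.map {f : Ω → E → Y} (hf : LocallyKnown A loc inf f) (F : Y → Z) :
    LocallyKnown A loc inf fun ω e => F (f ω e) :=
  fun ω ω' a h e he ha => congrArg F (hf ω ω' a h e he ha)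

theorem LocallyKnown.pair {f : Ω → E → Y} {g : Ω → E → Z} (hf : LocallyKnown A loc inf f)
    (hg : LocallyKnown A loc inf g) : LocallyKnown A loc inf fun ω e => (f ω e, g ω e) :=
  fun ω ω' a h e he ha => Prod.ext (hf ω ω' a h e he ha) (hg ω ω' a h e he ha)

/-- Since `loc` is part of the classifying map, every fibre lies at a single node, which therefore
knows the whole fibre. The round-robin is chosen as a function of that set alone, so
indistinguishable instances make the same choice. -/
theorem LocallyKnown.spread [Finite E] {s : ℕ} [NeZero s] {f : Ω → E → Y}
    (hf : LocallyKnown A loc inf f) :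
    LocallyKnown A loc inf fun ω e => _root_.spread s (A ω) (fun e => (loc ω e, f ω e)) e := by
  intro ω ω' a h e he ha
  have key : ∀ ω ω', Held A loc inf ω a = Held A loc inf ω' a → e ∈ A ω → loc ω e = a →
      {e' | e' ∈ A ω ∧ (loc ω e', f ω e') = (loc ω e, f ω e)} ⊆
      {e' | e' ∈ A ω' ∧ (loc ω' e', f ω' e') = (loc ω' e, f ω' e)} := by
    rintro ω ω' h he ha e' ⟨he', heq⟩
    simp only [Prod.mk.injEq] at heq
    have hl := heq.1.trans ha
    have h₁ := Held.mem_of_eq h he ha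
    have h₂ := Held.mem_of_eq h he' hl
    refine ⟨h₂.1, Prod.ext (h₂.2.1.trans h₁.2.1.symm) ?_⟩
    simp only
    rw [← hf ω ω' a h e he ha, ← hf ω ω' a h e' he' hl, heq.2]
  have h₁ := Held.mem_of_eq h he ha
  have hset := Set.Subset.antisymm (key ω ω' h he ha) (key ω' ω h.symm h₁.1 h₁.2.1)
  simp only [_root_.spread]
  congr! 1
  simp only [hset]

open Classical in
/-- The knowledge of the vertices that host the nodes of a virtual network. -/
noncomputable def Hosted {n : ℕ} (host : V → Fin n) (A : Ω → Set E) (loc : Ω → E → V)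
    (inf : Ω → E → X) (ω : Ω) (v : Fin n) : V → Set (E × X) :=
  fun a => if host a = v then Held A loc inf ω a else ∅

theorem Hosted.held_eq {n : ℕ} {host : V → Fin n} {ω ω' : Ω} {v : Fin n}
    (h : Hosted host A loc inf ω v = Hosted host A loc inf ω' v) {a : V} (ha : host a = v) :
    Held A loc inf ω a = Held A loc inf ω' a := by
  have := congrFun h a
  simpa only [Hosted, if_pos ha] using this

end Held

/-- A set of at most `k` elements is the image of `k` slots, each filled or empty. This prices a
whole bundle of messages sent over one link. -/
theorem card_boundedFinset_le {Y : Type} [Finite Y] (k : ℕ) :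
    Nat.card {s : Finset Y // s.card ≤ k} ≤ (Nat.card Y + 1) ^ k := by
  classical
  have := Fintype.ofFinite Y
  have h₁ : (Nat.card Y + 1) ^ k = Nat.card (Fin k → Option Y) := by simp
  rw [h₁]
  refine Nat.card_le_card_of_surjective
    (fun g => ⟨(Finset.univ.image g).eraseNone, ?_⟩) ?_
  · refine (Finset.card_le_card_of_injOn some ?_ (Option.some_injective _).injOn).trans
      ((Finset.card_image_le (f := g)).trans (Finset.card_fin k).le)
    intro y hy
    simpa using hy
  · rintro ⟨s, hs⟩
    refine ⟨fun i => if h : i.1 < s.card then some (s.equivFin.symm ⟨i.1, h⟩).1 else none, ?_⟩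
    refine Subtype.ext ?_
    ext y
    simp only [Finset.mem_eraseNone, Finset.mem_image, Finset.mem_univ, true_and]
    constructor
    · rintro ⟨i, hi⟩
      split_ifs at hi with h
      · have := Option.some.inj hi
        rw [← this]
        exact (s.equivFin.symm ⟨i.1, h⟩).2
    · intro hy
      refine ⟨⟨(s.equivFin ⟨y, hy⟩).1, (s.equivFin ⟨y, hy⟩).2.trans_le hs⟩, ?_⟩
      simp

theorem add_one_pow_le_two_pow_clog {n : ℕ} (hn : 2 ≤ n) {N b : ℕ} (hN : N ≤ n ^ b) (k : ℕ) :
    (N + 1) ^ k ≤ 2 ^ (k * (b + 1) * Nat.clog 2 n) := by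
  have h₁ : N + 1 ≤ n ^ (b + 1) := by
    have : 1 ≤ n ^ b := Nat.one_le_pow _ _ (by omega)
    rw [pow_succ]
    nlinarith
  have h₂ : n ≤ 2 ^ Nat.clog 2 n := Nat.le_pow_clog (by norm_num) n
  calc (N + 1) ^ k ≤ (n ^ (b + 1)) ^ k := Nat.pow_le_pow_left h₁ k
    _ ≤ (((2 ^ Nat.clog 2 n)) ^ (b + 1)) ^ k :=
      Nat.pow_le_pow_left (Nat.pow_le_pow_left h₂ _) _
    _ = _ := by rw [← pow_mul, ← pow_mul]; congr 1; ring

theorem ncard_le_mul_of_maps {E W : Type} [Finite E] [Finite W] (B : Set E) (S : Set W) (g : E → W)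
    (c : ℕ) (hS : ∀ e ∈ B, g e ∈ S) (hc : ∀ w ∈ S, {e | e ∈ B ∧ g e = w}.ncard ≤ c) :
    B.ncard ≤ S.ncard * c := by
  classical
  have := Fintype.ofFinite W
  have h := ncard_sep_mem_eq_sum B g S.toFinset
  have hB : {e | e ∈ B ∧ g e ∈ S.toFinset} = B := by
    ext e
    simp only [Set.mem_toFinset, Set.mem_ofPred_eq, and_iff_left_iff_imp]
    exact hS e
  rw [hB] at h
  rw [h, Set.ncard_eq_toFinset_card', ← smul_eq_mul, ← Finset.sum_const]
  exact Finset.sum_le_sum fun w hw => hc w (Set.mem_toFinset.1 hw)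

namespace Solves

/-- One step of all messages in a virtual network in which every vertex hosts at most `f` nodes and
every edge transports at most `c` messages. -/
theorem move {n : ℕ} (hn : 2 ≤ n) {Ω E V X X' : Type} [Finite E] [Finite V] [Finite X']
    {host : V → Fin n} {A : Ω → Set E} {loc loc' : Ω → E → V} {inf : Ω → E → X} {inf' : Ω → E → X'}
    {b f c : ℕ} (hloc : LocallyKnown A loc inf loc') (hinf : LocallyKnown A loc inf inf')
    (hcard : Nat.card (E × V × X') ≤ n ^ b) (hhost : ∀ v, {a | host a = v}.ncard ≤ f)
    (hcap : ∀ ω a a', {e | e ∈ A ω ∧ loc ω e = a ∧ loc' ω e = a'}.ncard ≤ c) :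
    Solves (Hosted host A loc inf) (Hosted host A loc' inf') (f * f * c * (b + 1)) := by
  classical
  have := Fintype.ofFinite E
  have := Fintype.ofFinite V
  have := Fintype.ofFinite X'
  -- All messages from `u` to `v` travel as one set. Each item carries its node of arrival, because
  -- `v` hosts several nodes; at most `f * f` links with `c` messages each join the two vertices.
  let M : Ω → Fin n → Fin n → Set (E × V × X') := fun ω u v =>
    {p | p.1 ∈ A ω ∧ host (loc ω p.1) = u ∧ loc' ω p.1 = p.2.1 ∧ host p.2.1 = v ∧
      inf' ω p.1 = p.2.2}
  have hM : ∀ ω u v, (M ω u v).ncard ≤ f * f * c := by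
    intro ω u v
    have h₁ : (M ω u v).ncard ≤
        {e | e ∈ A ω ∧ host (loc ω e) = u ∧ host (loc' ω e) = v}.ncard := by
      refine Set.ncard_le_ncard_of_injOn Prod.fst ?_ ?_
      · rintro p ⟨h₁, h₂, h₃, h₄, h₅⟩
        exact ⟨h₁, h₂, h₃ ▸ h₄⟩
      · rintro ⟨e, a, x⟩ ⟨h₁, h₂, h₃, h₄, h₅⟩ ⟨e', a', x'⟩ ⟨h₁', h₂', h₃', h₄', h₅'⟩ rfl
        simp only at *
        rw [← h₃, ← h₃', ← h₅, ← h₅']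
    refine h₁.trans ((ncard_le_mul_of_maps _ ({a | host a = u} ×ˢ {a | host a = v})
      (fun e => (loc ω e, loc' ω e)) c ?_ ?_).trans ?_)
    · rintro e ⟨-, h₂, h₃⟩
      exact ⟨h₂, h₃⟩
    · rintro ⟨a, a'⟩ -
      refine le_trans (Set.ncard_le_ncard ?_) (hcap ω a a')
      rintro e ⟨⟨h₁, -⟩, h₂⟩
      simp only [Prod.mk.injEq] at h₂
      exact ⟨h₁, h₂⟩
    · rw [Set.ncard_prod]
      exact Nat.mul_le_mul_right _ (Nat.mul_le_mul (hhost u) (hhost v))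
  let W := {s : Finset (E × V × X') // s.card ≤ f * f * c}
  have hW : Nonempty W := ⟨⟨∅, Nat.zero_le _⟩⟩
  let msg : Ω → Fin n → Fin n → W := fun ω u v =>
    ⟨(M ω u v).toFinset, by rw [← Set.ncard_eq_toFinset_card']; exact hM ω u v⟩
  have hex := Solves.exchange (inp := Hosted host A loc inf) (W := W) (f * f * c * (b + 1))
    ((card_boundedFinset_le _).trans (add_one_pow_le_two_pow_clog hn hcard _)) msg ?_
  · refine hex.weaken fun ω ω' v h => ?_
    simp only [Prod.mk.injEq] at h
    have hmsg : ∀ u, M ω u v = M ω' u v := by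
      intro u
      have := congrFun h.2 u
      exact Set.toFinset_inj.1 (congrArg Subtype.val this)
    funext a
    simp only [Hosted]
    split_ifs with ha
    · have key : ∀ ω ω', (∀ u, M ω u v = M ω' u v) →
          Held A loc' inf' ω a ⊆ Held A loc' inf' ω' a := by
        rintro ω ω' hmsg ⟨e, x⟩ ⟨h₁, h₂, h₃⟩
        have hp : (e, a, x) ∈ M ω' (host (loc ω e)) v := by
          rw [← hmsg]
          exact ⟨h₁, rfl, h₂, ha, h₃⟩
        exact ⟨hp.1, hp.2.2.1, hp.2.2.2.2⟩
      exact Set.Subset.antisymm (key ω ω' hmsg) (key ω' ω fun u => (hmsg u).symm)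
    · rfl
  · have key : ∀ ω ω' u v, Hosted host A loc inf ω u = Hosted host A loc inf ω' u →
        M ω u v ⊆ M ω' u v := by
      rintro ω ω' u v h ⟨e, a, x⟩ ⟨h₁, h₂, h₃, h₄, h₅⟩
      have hH := Hosted.held_eq h h₂
      have h' := Held.mem_of_eq hH h₁ rfl
      refine ⟨h'.1, ?_, ?_, h₄, ?_⟩
      · simp only at h₂ ⊢
        rw [h'.2.1]; exact h₂
      · exact (hloc ω ω' _ hH e h₁ rfl).symm.trans h₃
      · exact (hinf ω ω' _ hH e h₁ rfl).symm.trans h₅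
    intro ω ω' u h
    funext v
    refine Subtype.ext ?_
    simp only [msg, Set.toFinset_inj]
    exact Set.Subset.antisymm (key ω ω' u v h) (key ω' ω u v h.symm)

end Solves

/-! ### Deterministic routing with balanced loads. -/

namespace Solves

section Route

variable {n : ℕ} {Ω E : Type} [Finite E] {s : ℕ} [NeZero s] {host : Fin s × Fin s → Fin n}
  {A : Ω → Set E} {b f : ℕ}

/-- In a network with nodes `(g, j)`, messages are routed within every group `g`. The message from
`(g, i)` to `(g, j)` passes through `(k, i + j)`, where `k` runs evenly through all groups. -/
theorem routeInGroups (hn : 2 ≤ n) {X : Type} [Finite X] {loc tgt : Ω → E → Fin s × Fin s}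
    {inf : Ω → E → X} {c : ℕ} (htgt : LocallyKnown A loc inf tgt)
    (hgrp : ∀ ω, ∀ e ∈ A ω, (tgt ω e).1 = (loc ω e).1)
    (hcap : ∀ ω a a', {e | e ∈ A ω ∧ loc ω e = a ∧ tgt ω e = a'}.ncard ≤ c * s)
    (hcard : Nat.card (E × (Fin s × Fin s) × X × (Fin s × Fin s)) ≤ n ^ b)
    (hhost : ∀ v, {a | host a = v}.ncard ≤ f) :
    Solves (Hosted host A loc inf) (Hosted host A tgt inf) (2 * (f * f * (c + 1) * (b + 1))) := by
  classical
  have hs : 0 < s := Nat.pos_of_ne_zero (NeZero.ne s)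
  let mid : Ω → E → Fin s × Fin s := fun ω e =>
    (spread s (A ω) (fun e => (loc ω e, tgt ω e)) e, (loc ω e).2 + (tgt ω e).2)
  have hpair : ∀ ω (a a' : Fin s × Fin s),
      {e | e ∈ A ω ∧ (loc ω e, tgt ω e) ∈ ({(a, a')} : Finset _)}.ncard ≤ c * s := by
    intro ω a a'
    simpa only [Finset.mem_singleton, Prod.mk.injEq] using hcap ω a a'
  have h₁ : Solves (Hosted host A loc inf) (Hosted host A mid fun ω e => (inf ω e, tgt ω e))
      (f * f * (c + 1) * (b + 1)) := by
    refine move hn ?_ (LocallyKnown.of_inf.pair htgt) hcard hhost ?_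
    · exact htgt.spread.pair ((LocallyKnown.of_loc.pair htgt).map fun p => p.1.2 + p.2.2)
    · intro ω a a'
      -- The source and the second coordinate of the intermediate node determine the target by
      -- subtraction in `Fin s`. So a single fibre is spread over this link, with excess one; the
      -- second hop is symmetric.
      refine ncard_mul_le (A := A ω) (φ := fun e => (loc ω e, tgt ω e)) (j := a'.1)
        {(a, (a.1, a'.2 - a.2))} c 1 (by simp) ?_ (hpair ω _ _)
      rintro e ⟨he, ha, ha'⟩
      have hg := hgrp ω e he
      refine ⟨he, ?_, congrArg Prod.fst ha'⟩
      have h₂ : (loc ω e).2 + (tgt ω e).2 = a'.2 := congrArg Prod.snd ha'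
      simp only [Finset.mem_singleton]
      refine Prod.ext ha (Prod.ext (hg.trans (congrArg Prod.fst ha :)) ?_)
      simp only
      rw [← h₂, ← ha, add_sub_cancel_left]
  have h₂ : Solves (Hosted host A mid fun ω e => (inf ω e, tgt ω e)) (Hosted host A tgt inf)
      (f * f * (c + 1) * (b + 1)) := by
    refine move hn (LocallyKnown.of_inf.map Prod.snd) (LocallyKnown.of_inf.map Prod.fst) ?_ hhost ?_
    · refine le_trans ?_ hcard
      simp only [Nat.card_prod, Nat.card_fin]
      have : 1 ≤ s * s := Nat.mul_pos hs hs
      refine Nat.mul_le_mul_left _ (Nat.mul_le_mul_left _ ?_)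
      exact Nat.le_mul_of_pos_right _ this
    · intro ω a a'
      refine ncard_mul_le (A := A ω) (φ := fun e => (loc ω e, tgt ω e)) (j := a.1)
        {((a'.1, a.2 - a'.2), a')} c 1 (by simp) ?_ (hpair ω _ _)
      rintro e ⟨he, ha, ha'⟩
      have hg := hgrp ω e he
      refine ⟨he, ?_, congrArg Prod.fst ha⟩
      have h₂ : (loc ω e).2 + (tgt ω e).2 = a.2 := congrArg Prod.snd ha
      simp only [Finset.mem_singleton]
      refine Prod.ext (Prod.ext (hg.symm.trans (congrArg Prod.fst ha' :)) ?_) ha'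
      simp only
      rw [← h₂, ← ha', add_sub_cancel_right]
  exact (h₁.comp h₂).mono (by omega)

/-- Deterministic routing in a virtual network of `s * s` nodes, each of which is the source and the
destination of at most `L * (s * s)` messages. -/
theorem routeVirtual (hn : 2 ≤ n) {X : Type} [Finite X] {src dst : Ω → E → Fin s × Fin s}
    {val : Ω → E → X} {L : ℕ}
    (hsrc : ∀ ω a, {e | e ∈ A ω ∧ src ω e = a}.ncard ≤ L * (s * s))
    (hdst : ∀ ω a, {e | e ∈ A ω ∧ dst ω e = a}.ncard ≤ L * (s * s))
    (hcard : Nat.card (E × (Fin s × Fin s) × ((Fin s × Fin s) × X) × (Fin s × Fin s)) ≤ n ^ b)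
    (hhost : ∀ v, {a | host a = v}.ncard ≤ f) :
    Solves (Hosted host A src fun ω e => (dst ω e, val ω e))
      (Hosted host A dst fun ω e => (dst ω e, val ω e)) (8 * (f * f * (L + 5) * (b + 1))) := by
  classical
  have hs : 0 < s := Nat.pos_of_ne_zero (NeZero.ne s)
  have hcard' : Nat.card (E × (Fin s × Fin s) × ((Fin s × Fin s) × X)) ≤ n ^ b := by
    refine le_trans ?_ hcard
    simp only [Nat.card_prod, Nat.card_fin]
    have : 1 ≤ s * s := Nat.mul_pos hs hs
    refine Nat.mul_le_mul_left _ (Nat.mul_le_mul_left _ ?_)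
    exact Nat.le_mul_of_pos_right _ this
  let inf : Ω → E → (Fin s × Fin s) × X := fun ω e => (dst ω e, val ω e)
  have hinf : ∀ loc : Ω → E → Fin s × Fin s, LocallyKnown A loc inf inf := fun loc =>
    LocallyKnown.of_inf
  have hk : ∀ loc : Ω → E → Fin s × Fin s, LocallyKnown A loc inf dst := fun loc =>
    (hinf loc).map Prod.fst
  have hcapsum : ∀ (loc loc' : Ω → E → Fin s × Fin s) (c : ℕ),
      (∀ ω a a', {e | e ∈ A ω ∧ loc ω e = a ∧ loc' ω e = a'}.ncard ≤ c) →
      ∀ ω a', {e | e ∈ A ω ∧ loc' ω e = a'}.ncard ≤ c * s * s := by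
    intro loc loc' c h ω a'
    refine (ncard_le_mul_of_maps _ Set.univ (loc ω) c (fun _ _ => Set.mem_univ _) ?_).trans ?_
    · intro a _
      refine le_trans (Set.ncard_le_ncard ?_) (h ω a a')
      rintro e ⟨⟨h₁, h₂⟩, h₃⟩
      exact ⟨h₁, h₃, h₂⟩
    · rw [Set.ncard_univ]
      simp only [Nat.card_prod, Nat.card_fin]
      exact le_of_eq (by ring)
  -- the first step spreads the messages for each group to all groups
  let g₁ : Ω → E → Fin s := fun ω => spread s (A ω) fun e => (src ω e, (dst ω e).1)
  let loc₁ : Ω → E → Fin s × Fin s := fun ω e =>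
    (g₁ ω e, spread s (A ω) (fun e => (src ω e, g₁ ω e)) e)
  have kg₁ : LocallyKnown A src inf g₁ := ((hk src).map Prod.fst).spread
  have b₁ : ∀ ω a j, {e | e ∈ A ω ∧ src ω e = a ∧ g₁ ω e = j}.ncard ≤ (L + 1) * s := by
    intro ω a j
    refine (ncard_mul_le (A := A ω) (φ := fun e => (src ω e, (dst ω e).1)) (j := j)
      ({a} ×ˢ Finset.univ) (L * s) s (by simp) ?_ ?_).trans (le_of_eq (by ring))
    · rintro e ⟨he, ha, hj⟩
      exact ⟨he, by simpa only [Finset.mem_product, Finset.mem_singleton, Finset.mem_univ, and_true,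
        true_and] using ha, hj⟩
    · refine le_trans (Set.ncard_le_ncard ?_) ((hsrc ω a).trans (le_of_eq (by ring)))
      rintro e ⟨he, ha⟩
      exact ⟨he, by simpa only [Finset.mem_product, Finset.mem_singleton, Finset.mem_univ, and_true,
        true_and] using ha⟩
  have c₁ : ∀ ω a a', {e | e ∈ A ω ∧ src ω e = a ∧ loc₁ ω e = a'}.ncard ≤ L + 2 := by
    intro ω a a'
    refine (ncard_mul_le (A := A ω) (φ := fun e => (src ω e, g₁ ω e)) (j := a'.2)
      {(a, a'.1)} (L + 1) 1 (by simp) ?_ ?_).trans (le_of_eq (by ring))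
    · rintro e ⟨he, ha, ha'⟩
      refine ⟨he, ?_, congrArg Prod.snd ha'⟩
      simp only [Finset.mem_singleton]
      exact Prod.ext ha (congrArg Prod.fst ha' :)
    · simpa only [Finset.mem_singleton, Prod.mk.injEq] using b₁ ω a a'.1
  -- Only here and in `d₄` does the load of the destinations enter: group `q` receives at most `s *
  -- (L * (s * s))` messages in all, and spreading leaves each group `j` an `s`-th part, plus one
  -- for each of the `s * s` sources.
  have d₁ : ∀ ω j q, {e | e ∈ A ω ∧ (loc₁ ω e).1 = j ∧ (dst ω e).1 = q}.ncard ≤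
      (L + 1) * (s * s) := by
    intro ω j q
    refine (ncard_mul_le (A := A ω) (φ := fun e => (src ω e, (dst ω e).1)) (j := j)
      (Finset.univ ×ˢ {q}) (L * (s * s)) (s * s) (by simp) ?_ ?_).trans (le_of_eq (by ring))
    · rintro e ⟨he, ha, hj⟩
      exact ⟨he, by simpa only [Finset.mem_product, Finset.mem_singleton, Finset.mem_univ, and_true,
        true_and] using hj, ha⟩
    · refine (ncard_le_mul_of_maps _ Set.univ (fun e => (dst ω e).2) (L * (s * s))
        (fun _ _ => Set.mem_univ _) ?_).trans ?_
      · intro w _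
        refine le_trans (Set.ncard_le_ncard ?_) (hdst ω (q, w))
        rintro e ⟨⟨he, hq⟩, hw⟩
        exact ⟨he, Prod.ext (by simpa only [Finset.mem_product, Finset.mem_singleton, Finset.mem_univ, and_true,
        true_and] using hq) hw⟩
      · rw [Set.ncard_univ, Nat.card_fin, mul_comm]
  have t₁ := move (inf' := inf) hn (kg₁.pair kg₁.spread) (hinf src) hcard' hhost c₁
  -- the second step balances the messages for each group within every group
  let loc₂ : Ω → E → Fin s × Fin s := fun ω e =>
    ((loc₁ ω e).1, spread s (A ω) (fun e => (loc₁ ω e, (dst ω e).1)) e)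
  have k₂ : LocallyKnown A loc₁ inf loc₂ :=
    (LocallyKnown.of_loc.map Prod.fst).pair ((hk loc₁).map Prod.fst).spread
  have c₂ : ∀ ω a a', {e | e ∈ A ω ∧ loc₁ ω e = a ∧ loc₂ ω e = a'}.ncard ≤ (L + 3) * s := by
    intro ω a a'
    refine (ncard_mul_le (A := A ω) (φ := fun e => (loc₁ ω e, (dst ω e).1)) (j := a'.2)
      ({a} ×ˢ Finset.univ) ((L + 2) * s) s (by simp) ?_ ?_).trans (le_of_eq (by ring))
    · rintro e ⟨he, ha, ha'⟩
      exact ⟨he, by simpa only [Finset.mem_product, Finset.mem_singleton, Finset.mem_univ, and_true,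
        true_and] using ha, congrArg Prod.snd ha'⟩
    · refine le_trans (Set.ncard_le_ncard ?_) (hcapsum src loc₁ _ c₁ ω a)
      rintro e ⟨he, ha⟩
      exact ⟨he, by simpa only [Finset.mem_product, Finset.mem_singleton, Finset.mem_univ, and_true,
        true_and] using ha⟩
  have d₂ : ∀ ω a q, {e | e ∈ A ω ∧ loc₂ ω e = a ∧ (dst ω e).1 = q}.ncard ≤ (L + 2) * s := by
    intro ω a q
    refine (ncard_mul_le (A := A ω) (φ := fun e => (loc₁ ω e, (dst ω e).1)) (j := a.2)
      (({a.1} ×ˢ Finset.univ) ×ˢ {q}) ((L + 1) * s) s (by simp) ?_ ?_).trans (le_of_eq (by ring))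
    · rintro e ⟨he, ha, hq⟩
      refine ⟨he, ?_, congrArg Prod.snd ha⟩
      simp only [Finset.mem_product, Finset.mem_singleton, Finset.mem_univ, and_true]
      exact ⟨(congrArg Prod.fst ha :), hq⟩
    · refine le_trans (Set.ncard_le_ncard ?_) ((d₁ ω a.1 q).trans (le_of_eq (by ring)))
      rintro e ⟨he, ha⟩
      simp only [Finset.mem_product, Finset.mem_singleton, Finset.mem_univ, and_true] at ha
      exact ⟨he, ha⟩
  have t₂ := routeInGroups hn k₂ (fun ω e _ => rfl) c₂ hcard hhost
  -- the third step sends the messages to their groups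
  let loc₃ : Ω → E → Fin s × Fin s := fun ω e =>
    ((dst ω e).1, spread s (A ω) (fun e => (loc₂ ω e, (dst ω e).1)) e)
  have c₃ : ∀ ω a a', {e | e ∈ A ω ∧ loc₂ ω e = a ∧ loc₃ ω e = a'}.ncard ≤ L + 3 := by
    intro ω a a'
    refine (ncard_mul_le (A := A ω) (φ := fun e => (loc₂ ω e, (dst ω e).1)) (j := a'.2)
      {(a, a'.1)} (L + 2) 1 (by simp) ?_ ?_).trans (le_of_eq (by ring))
    · rintro e ⟨he, ha, ha'⟩
      refine ⟨he, ?_, congrArg Prod.snd ha'⟩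
      simp only [Finset.mem_singleton]
      exact Prod.ext ha (congrArg Prod.fst ha' :)
    · simpa only [Finset.mem_singleton, Prod.mk.injEq] using d₂ ω a a'.1
  have t₃ := move (inf' := inf) hn
    (((hk loc₂).map Prod.fst).pair ((hk loc₂).map Prod.fst).spread) (hinf loc₂) hcard' hhost c₃
  -- the fourth step balances the messages for each node within its group
  let loc₄ : Ω → E → Fin s × Fin s := fun ω e =>
    ((loc₃ ω e).1, spread s (A ω) (fun e => (loc₃ ω e, (dst ω e).2)) e)
  have k₄ : LocallyKnown A loc₃ inf loc₄ :=
    (LocallyKnown.of_loc.map Prod.fst).pair ((hk loc₃).map Prod.snd).spread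
  have c₄ : ∀ ω a a', {e | e ∈ A ω ∧ loc₃ ω e = a ∧ loc₄ ω e = a'}.ncard ≤ (L + 4) * s := by
    intro ω a a'
    refine (ncard_mul_le (A := A ω) (φ := fun e => (loc₃ ω e, (dst ω e).2)) (j := a'.2)
      ({a} ×ˢ Finset.univ) ((L + 3) * s) s (by simp) ?_ ?_).trans (le_of_eq (by ring))
    · rintro e ⟨he, ha, ha'⟩
      exact ⟨he, by simpa only [Finset.mem_product, Finset.mem_singleton, Finset.mem_univ, and_true,
        true_and] using ha, congrArg Prod.snd ha'⟩
    · refine le_trans (Set.ncard_le_ncard ?_) (hcapsum loc₂ loc₃ _ c₃ ω a)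
      rintro e ⟨he, ha⟩
      exact ⟨he, by simpa only [Finset.mem_product, Finset.mem_singleton, Finset.mem_univ, and_true,
        true_and] using ha⟩
  have d₄ : ∀ ω a a', {e | e ∈ A ω ∧ loc₄ ω e = a ∧ dst ω e = a'}.ncard ≤ (L + 1) * s := by
    intro ω a a'
    refine (ncard_mul_le (A := A ω) (φ := fun e => (loc₃ ω e, (dst ω e).2)) (j := a.2)
      (({a'.1} ×ˢ Finset.univ) ×ˢ {a'.2}) (L * s) s (by simp) ?_ ?_).trans (le_of_eq (by ring))
    · rintro e ⟨he, ha, ha'⟩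
      refine ⟨he, ?_, congrArg Prod.snd ha⟩
      simp only [Finset.mem_product, Finset.mem_singleton, Finset.mem_univ, and_true]
      exact ⟨(congrArg Prod.fst ha' :), (congrArg Prod.snd ha' :)⟩
    · refine le_trans (Set.ncard_le_ncard ?_) ((hdst ω a').trans (le_of_eq (by ring)))
      rintro e ⟨he, ha⟩
      simp only [Finset.mem_product, Finset.mem_singleton, Finset.mem_univ, and_true] at ha
      exact ⟨he, Prod.ext ha.1 ha.2⟩
  have t₄ := routeInGroups hn k₄ (fun ω e _ => rfl) c₄ hcard hhost
  have t₅ := routeInGroups hn (hk loc₄) (fun ω e _ => rfl) d₄ hcard hhost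
  -- Two direct moves and three routings inside groups, of two moves each, make eight moves.
  refine ((((t₁.comp t₂).comp t₃).comp t₄).comp t₅).mono ?_
  have e : ∀ c, c ≤ L + 5 → f * f * c * (b + 1) ≤ f * f * (L + 5) * (b + 1) := fun c hc =>
    Nat.mul_le_mul_right _ (Nat.mul_le_mul_left _ hc)
  have e₁ := e (L + 2) (by omega)
  have e₂ := e (L + 3 + 1) (by omega)
  have e₃ := e (L + 3) (by omega)
  have e₄ := e (L + 4 + 1) (by omega)
  have e₅ := e (L + 1 + 1) (by omega)
  omega

end Route

/-- The vertices host the nodes of a square network of at least as many nodes. -/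
theorem exists_host {n : ℕ} (hn : 2 ≤ n) : ∃ (s : ℕ) (_ : NeZero s) (host : Fin s × Fin s → Fin n)
    (emb : Fin n → Fin s × Fin s), n ≤ s * s ∧ s * s ≤ n ^ 3 ∧ (∀ v, host (emb v) = v) ∧
      ∀ v, {a | host a = v}.ncard ≤ 4 := by
  classical
  have hn0 : 0 < n := by omega
  -- This is `⌈√n⌉`, so `s * s ≤ 3 * n`; reading a node as a number in base `s` and reducing it
  -- modulo `n` gives every vertex boundedly many nodes.
  let s := Nat.sqrt (n - 1) + 1
  have hs : 0 < s := Nat.succ_pos _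
  have h₁ : n ≤ s * s := by
    have := Nat.lt_succ_sqrt (n - 1)
    simp only [s]
    exact Nat.le_of_pred_lt this
  have h₂ : s * s ≤ 3 * n := by
    have h := Nat.sqrt_le (n - 1)
    have h' := Nat.sqrt_le_self (n - 1)
    simp only [s]
    nlinarith [Nat.sub_le n 1]
  refine ⟨s, ⟨hs.ne'⟩, fun a => ⟨(a.1 * s + a.2) % n, Nat.mod_lt _ hn0⟩,
    fun v => (⟨v / s, ?_⟩, ⟨v % s, Nat.mod_lt _ hs⟩), h₁, ?_, ?_, ?_⟩
  · exact Nat.div_lt_of_lt_mul (v.2.trans_le h₁)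
  · refine h₂.trans ?_
    have : 4 ≤ n ^ 2 := by nlinarith
    rw [pow_succ]
    nlinarith
  · intro v
    refine Fin.ext ?_
    simp only
    rw [Nat.div_add_mod', Nat.mod_eq_of_lt v.2]
  · intro v
    have : {a : Fin s × Fin s | (⟨(a.1 * s + a.2) % n, Nat.mod_lt _ hn0⟩ : Fin n) = v}.ncard ≤
        (Finset.range 4 : Set ℕ).ncard := by
      refine Set.ncard_le_ncard_of_injOn (fun a => (a.1 * s + a.2) / n) ?_ ?_ (Finset.finite_toSet _)
      · rintro a -
        simp only [Finset.coe_range, Set.mem_Iio]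
        refine Nat.div_lt_of_lt_mul ?_
        have := a.1.2
        have := a.2.2
        nlinarith
      · rintro a ha a' ha' haa
        have e₁ : (a.1 * s + a.2) % n = (a'.1 * s + a'.2) % n :=
          (congrArg Fin.val ha).trans (congrArg Fin.val ha').symm
        have e₂ : (a.1 : ℕ) * s + a.2 = a'.1 * s + a'.2 := by
          rw [← Nat.div_add_mod (a.1 * s + a.2) n, ← Nat.div_add_mod (a'.1 * s + a'.2) n, e₁]
          simp only at haa
          rw [haa]
        have e₃ := congrArg (· / s) e₂
        have e₄ := congrArg (· % s) e₂
        simp only [Nat.mul_add_mod', Nat.mod_eq_of_lt a.2.2, Nat.mod_eq_of_lt a'.2.2] at e₄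
        rw [e₄] at e₂
        have e₅ : (a.1 : ℕ) * s = a'.1 * s := Nat.add_right_cancel e₂
        exact Prod.ext (Fin.ext (Nat.eq_of_mul_eq_mul_right hs e₅)) (Fin.ext e₄)
    rwa [Set.ncard_coe_finset, Finset.card_range] at this

/-- Deterministic routing: if every vertex is the source and the destination of at most `L * n`
messages, then these are delivered within `O(L)` rounds. -/
theorem route {n : ℕ} (hn : 2 ≤ n) {Ω I E X : Type} [Nonempty I] [Finite E] [Finite X]
    {inp : Ω → Fin n → I} {A : Ω → Set E} {src dst : Ω → E → Fin n} {val : Ω → E → X} {b L : ℕ}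
    (hcard : Nat.card (E × X) ≤ n ^ b)
    (hsrc : ∀ ω v, {e | e ∈ A ω ∧ src ω e = v}.ncard ≤ L * n)
    (hdst : ∀ ω v, {e | e ∈ A ω ∧ dst ω e = v}.ncard ≤ L * n)
    (hknow : ∀ ω ω' v, inp ω v = inp ω' v → ∀ e ∈ A ω, src ω e = v →
      e ∈ A ω' ∧ src ω' e = v ∧ dst ω' e = dst ω e ∧ val ω' e = val ω e) :
    Solves inp (fun ω v => (inp ω v, {p : E × X | p.1 ∈ A ω ∧ dst ω p.1 = v ∧ val ω p.1 = p.2}))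
      (128 * (L + 5) * (b + 10)) := by
  obtain ⟨s, hs, host, emb, h₁, h₂, h₃, h₄⟩ := exists_host hn
  have hinj : Function.Injective emb := Function.LeftInverse.injective h₃
  let inf : Ω → E → (Fin s × Fin s) × X := fun ω e => (emb (dst ω e), val ω e)
  have hcard' : Nat.card (E × (Fin s × Fin s) × ((Fin s × Fin s) × X) × (Fin s × Fin s)) ≤
      n ^ (b + 9) := by
    have : Nat.card (E × (Fin s × Fin s) × ((Fin s × Fin s) × X) × (Fin s × Fin s)) =
        Nat.card (E × X) * ((s * s) * (s * s) * (s * s)) := by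
      simp only [Nat.card_prod, Nat.card_fin]
      ring
    rw [this, pow_add]
    refine Nat.mul_le_mul hcard ?_
    calc _ ≤ n ^ 3 * n ^ 3 * n ^ 3 := Nat.mul_le_mul (Nat.mul_le_mul h₂ h₂) h₂
      _ = n ^ 9 := by ring
  have hload : ∀ loc : Ω → E → Fin n, (∀ ω v, {e | e ∈ A ω ∧ loc ω e = v}.ncard ≤ L * n) →
      ∀ ω a, {e | e ∈ A ω ∧ emb (loc ω e) = a}.ncard ≤ L * (s * s) := by
    intro loc h ω a
    refine le_trans (Set.ncard_le_ncard ?_) ((h ω (host a)).trans (Nat.mul_le_mul_left _ h₁))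
    rintro e ⟨he, rfl⟩
    exact ⟨he, (h₃ _).symm⟩
  have hstart : Solves inp (Hosted host A (fun ω e => emb (src ω e)) inf) 0 := by
    refine of_determines fun ω ω' v h => ?_
    funext a
    simp only [Hosted]
    split_ifs with ha
    · have key : ∀ ω ω', inp ω v = inp ω' v → Held A (fun ω e => emb (src ω e)) inf ω a ⊆
          Held A (fun ω e => emb (src ω e)) inf ω' a := by
        rintro ω ω' h ⟨e, x⟩ ⟨he, hl, hx⟩
        have hv : src ω e = v := by
          rw [← ha, ← hl]
          exact (h₃ _).symm
        obtain ⟨k₁, k₂, k₃, k₄⟩ := hknow ω ω' v h e he hv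
        refine ⟨k₁, ?_, ?_⟩
        · simp only at hl ⊢
          rw [k₂, ← hl, hv]
        · simp only [inf] at hx ⊢
          rw [k₃, k₄, hx]
      exact Set.Subset.antisymm (key ω ω' h) (key ω' ω h.symm)
    · rfl
  have hroute := routeVirtual (A := A) (val := val) hn (hload src hsrc) (hload dst hdst) hcard' h₄
  -- With `f = 4` the factor is `8 * 4 * 4 = 128`; the three node addresses carried along raise the
  -- exponent from `b` to `b + 9`.
  refine ((hstart.comp hroute).keep.weaken fun ω ω' v h => ?_).mono (le_of_eq (by ring))
  simp only [Prod.mk.injEq] at h ⊢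
  refine ⟨h.1, ?_⟩
  have hH := Hosted.held_eq h.2 (h₃ v)
  have key : ∀ ω ω', Held A (fun ω e => emb (dst ω e)) inf ω (emb v) =
      Held A (fun ω e => emb (dst ω e)) inf ω' (emb v) →
      {p : E × X | p.1 ∈ A ω ∧ dst ω p.1 = v ∧ val ω p.1 = p.2} ⊆
      {p : E × X | p.1 ∈ A ω' ∧ dst ω' p.1 = v ∧ val ω' p.1 = p.2} := by
    rintro ω ω' hH ⟨e, x⟩ ⟨he, hd, hx⟩
    obtain ⟨k₁, k₂, k₃⟩ := Held.mem_of_eq hH he (congrArg emb hd)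
    refine ⟨k₁, hinj k₂, ?_⟩
    have := congrArg Prod.snd k₃
    exact this.trans hx
  exact Set.Subset.antisymm (key ω ω' hH) (key ω' ω hH.symm)

end Solves

/-! ### Positions and digits -/

theorem position_lt_card {n : ℕ} {W : Finset (Fin n)} {u : Fin n} (hu : u ∈ W) :
    position W u < W.card :=
  Finset.card_lt_card (Finset.filter_ssubset.2 ⟨u, hu, lt_irrefl u⟩)

theorem position_injOn {n : ℕ} (W : Finset (Fin n)) : Set.InjOn (position W) W := by
  have key : ∀ u w : Fin n, u ∈ W → u < w → position W u < position W w := by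
    intro u w hu huw
    refine Finset.card_lt_card ⟨fun z hz => ?_, fun h => ?_⟩
    · rw [Finset.mem_filter] at hz ⊢
      exact ⟨hz.1, hz.2.trans huw⟩
    · have := h (Finset.mem_filter.2 ⟨hu, huw⟩)
      exact lt_irrefl u (Finset.mem_filter.1 this).2
  intro u hu w hw h
  rcases lt_trichotomy u w with h' | h' | h'
  · exact absurd h (key u w hu h').ne
  · exact h'
  · exact absurd h.symm (key w u hw h').ne

theorem le_mul_outerSize_sq {m : ℕ} (hm : 0 < m) (k : ℕ) : k ≤ m * outerSize k m ^ 2 := by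
  have hne : {t : ℕ | k ≤ m * t ^ 2}.Nonempty := by
    refine ⟨k, ?_⟩
    simp only [Set.mem_ofPred_eq]
    nlinarith [Nat.le_self_pow (two_ne_zero) k]
  exact Nat.sInf_mem hne

theorem mul_sq_lt_of_lt_outerSize {k m t : ℕ} (ht : t < outerSize k m) : m * t ^ 2 < k :=
  not_le.1 fun h => Nat.notMem_of_lt_sInf (s := {t : ℕ | k ≤ m * t ^ 2}) ht h

/-- By minimality `t = outerSize k m` satisfies `m (t - 1)² < k`, and `t ≤ 2 (t - 1)` once `t ≥ 2`.
A block has at most `t² × t²` entries, so this bounds the load of its owner. -/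
theorem outerSize_pow_four_le {k m n B : ℕ} (hm : 0 < m) (hB : 0 < B) (hn : 0 < n)
    (hk : k ^ 2 ≤ B * n * m ^ 2) : outerSize k m ^ 4 ≤ 16 * B * n := by
  rcases Nat.lt_or_ge (outerSize k m) 2 with h | h
  · have h₁ : outerSize k m ^ 4 ≤ 1 ^ 4 := Nat.pow_le_pow_left (by omega) 4
    have : 1 ≤ B * n := Nat.mul_pos hB hn
    nlinarith
  · obtain ⟨t, ht⟩ : ∃ t, outerSize k m = t + 1 := ⟨outerSize k m - 1, by omega⟩
    have h₁ : m * t ^ 2 < k := mul_sq_lt_of_lt_outerSize (by omega)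
    have h₂ : outerSize k m ^ 4 ≤ (2 * t) ^ 4 := Nat.pow_le_pow_left (by omega) 4
    have h₃ : (m * t ^ 2) ^ 2 ≤ B * n * m ^ 2 := (Nat.pow_le_pow_left h₁.le 2).trans hk
    have h₄ : t ^ 4 * m ^ 2 ≤ B * n * m ^ 2 := by
      calc _ = (m * t ^ 2) ^ 2 := by ring
        _ ≤ _ := h₃
    have h₅ : t ^ 4 ≤ B * n := Nat.le_of_mul_le_mul_right h₄ (by positivity)
    calc _ ≤ _ := h₂
      _ = 16 * t ^ 4 := by ring
      _ ≤ 16 * (B * n) := Nat.mul_le_mul_left _ h₅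
      _ = _ := by ring

/-- Once the middle digit is fixed, the position is determined by its first and last digits, each
below `outerSize W.card m`. -/
theorem ncard_inPart_le {n m : ℕ} (hm : 0 < m) (W : Finset (Fin n)) (x : ℕ) :
    {u | InPart W m x u}.ncard ≤ outerSize W.card m ^ 2 := by
  set t := outerSize W.card m with ht
  have h₁ : {u | InPart W m x u}.ncard ≤
      ((Finset.range t ×ˢ Finset.range t : Finset (ℕ × ℕ)) : Set (ℕ × ℕ)).ncard := by
    refine Set.ncard_le_ncard_of_injOn
      (fun u => (position W u / t / m, position W u % t)) ?_ ?_ (Finset.finite_toSet _)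
    · rintro u ⟨hu, -⟩
      have h₂ := position_lt_card hu
      have h₃ := le_mul_outerSize_sq hm W.card
      rw [← ht] at h₃
      have ht0 : 0 < t := by
        rcases Nat.eq_zero_or_pos t with h0 | h0
        · rw [h0] at h₃; simp at h₃; rw [h₃] at hu; simp at hu
        · exact h0
      simp only [Finset.coe_product, Finset.coe_range, Set.mem_prod, Set.mem_Iio]
      refine ⟨?_, Nat.mod_lt _ ht0⟩
      rw [Nat.div_div_eq_div_mul]
      refine Nat.div_lt_of_lt_mul (h₂.trans_le (h₃.trans (le_of_eq (by ring))))
    · rintro u ⟨hu, hux⟩ w ⟨hw, hwx⟩ h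
      refine position_injOn W hu hw ?_
      simp only [Prod.mk.injEq] at h
      simp only [middleDigit, ← ht] at hux hwx
      rw [← Nat.div_add_mod (position W u) t, ← Nat.div_add_mod (position W w) t, h.2,
        ← Nat.div_add_mod (position W u / t) m, ← Nat.div_add_mod (position W w / t) m, h.1, hux,
        hwx]
  rwa [Set.ncard_coe_finset, Finset.card_product, Finset.card_range, ← pow_two] at h₁

/-- The part of `W` to which the vertex `u` belongs. -/
noncomputable def part {n : ℕ} (m : ℕ) [NeZero m] (W : Finset (Fin n)) (u : Fin n) : Fin m :=
  ⟨middleDigit W.card m (position W u), Nat.mod_lt _ (NeZero.pos m)⟩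

theorem inPart_part {n m : ℕ} [NeZero m] {W : Finset (Fin n)} {u : Fin n} (hu : u ∈ W) :
    InPart W m (part m W u) u := ⟨hu, rfl⟩

theorem InPart.part_eq {n m : ℕ} [NeZero m] {W : Finset (Fin n)} {x : Fin m} {u : Fin n}
    (h : InPart W m x u) : part m W u = x := Fin.ext h.2

/-- The position of `u` in `W`, written with two digits below `d` and `q`. -/
def digits {n : ℕ} (d q : ℕ) [NeZero d] [NeZero q] (W : Finset (Fin n)) (u : Fin n) :
    Fin d × Fin q :=
  (⟨position W u / q % d, Nat.mod_lt _ (NeZero.pos d)⟩, ⟨position W u % q, Nat.mod_lt _ (NeZero.pos q)⟩)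

section Digits

variable {n d q : ℕ} [NeZero d] [NeZero q] {W : Finset (Fin n)}

theorem digits_injOn (hW : W.card ≤ d * q) : Set.InjOn (digits d q W) W := by
  intro u hu w hw h
  refine position_injOn W hu hw ?_
  simp only [digits, Prod.mk.injEq, Fin.mk.injEq] at h
  have hlt : ∀ z ∈ W, position W z / q % d = position W z / q := fun z hz =>
    Nat.mod_eq_of_lt (Nat.div_lt_of_lt_mul
      (((position_lt_card hz).trans_le hW).trans_le (le_of_eq (mul_comm d q))))
  rw [hlt u hu, hlt w hw] at h
  rw [← Nat.div_add_mod (position W u) q, ← Nat.div_add_mod (position W w) q, h.1, h.2]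

theorem ncard_lowDigit_le (hW : W.card ≤ d * q) (b : Fin q) :
    {u | u ∈ W ∧ (digits d q W u).2 = b}.ncard ≤ d := by
  have h := Set.ncard_le_ncard_of_injOn (s := {u | u ∈ W ∧ (digits d q W u).2 = b})
    (t := (Set.univ : Set (Fin d))) (fun u => (digits d q W u).1) (fun _ _ => Set.mem_univ _)
    (fun u hu w hw h => digits_injOn hW hu.1 hw.1 (Prod.ext h (hu.2.trans hw.2.symm)))
  simpa [Set.ncard_univ] using h

variable {F : Type} [Field F]

/-- The incidence matrix between vertices of `W` and the digits of their positions. -/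
noncomputable def digitMatrix (F : Type) [Field F] (d q : ℕ) [NeZero d] [NeZero q]
    (W : Finset (Fin n)) : Matrix (Fin n) (Fin d × Fin q) F :=
  Matrix.of fun u z => if u ∈ W ∧ digits d q W u = z then 1 else 0

/-- The matrix `S` on the vertices of `W`, with its rows and columns indexed by digits. -/
noncomputable def toDigits (d q : ℕ) [NeZero d] [NeZero q] (W : Finset (Fin n))
    (S : Matrix (Fin n) (Fin n) F) : Matrix (Fin d × Fin q) (Fin d × Fin q) F :=
  Matrix.of fun y z => ∑ u, ∑ w, digitMatrix F d q W u y * S u w * digitMatrix F d q W w z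

/-- All nonzero entries are in rows and columns of `W`. -/
def SupportedOn (W : Finset (Fin n)) (S : Matrix (Fin n) (Fin n) F) : Prop :=
  ∀ u w, S u w ≠ 0 → u ∈ W ∧ w ∈ W

theorem SupportedOn.mul {S S' : Matrix (Fin n) (Fin n) F} (h : SupportedOn W S)
    (h' : SupportedOn W S') : SupportedOn W (S * S') := by
  intro u w hne
  rw [Matrix.mul_apply] at hne
  obtain ⟨z, -, hz⟩ := Finset.exists_ne_zero_of_sum_ne_zero hne
  exact ⟨(h u z (left_ne_zero_of_mul hz)).1, (h' z w (right_ne_zero_of_mul hz)).2⟩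

theorem toDigits_apply_digits (hW : W.card ≤ d * q) (S : Matrix (Fin n) (Fin n) F) {u w : Fin n}
    (hu : u ∈ W) (hw : w ∈ W) : toDigits d q W S (digits d q W u) (digits d q W w) = S u w := by
  have key : ∀ u ∈ W, ∀ u', digitMatrix F d q W u' (digits d q W u) = if u' = u then 1 else 0 := by
    intro u hu u'
    simp only [digitMatrix, Matrix.of_apply]
    refine if_congr ⟨fun h => digits_injOn hW h.1 hu h.2, ?_⟩ rfl rfl
    rintro rfl
    exact ⟨hu, rfl⟩
  simp only [toDigits, Matrix.of_apply, key u hu, key w hw]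
  simp

/-- With `J` the incidence matrix, `toDigits` is `R ↦ Jᵀ R J`, and `J Jᵀ` is the projection to the
coordinates in `W`, which fixes `S` from the right. Digit pairs that are not positions in `W` merely
pad with zeros. -/
theorem toDigits_mul (hW : W.card ≤ d * q) {S S' : Matrix (Fin n) (Fin n) F}
    (h : SupportedOn W S) :
    toDigits d q W (S * S') = toDigits d q W S * toDigits d q W S' := by
  have e : ∀ R : Matrix (Fin n) (Fin n) F,
      toDigits d q W R = (digitMatrix F d q W).transpose * R * digitMatrix F d q W := by
    intro R
    ext y z
    simp only [toDigits, Matrix.of_apply, Matrix.mul_apply, Matrix.transpose_apply,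
      Finset.sum_mul]
    exact Finset.sum_comm
  have hJ : S * (digitMatrix F d q W * (digitMatrix F d q W).transpose) = S := by
    ext u w
    rw [Matrix.mul_apply, Finset.sum_eq_single w]
    · by_cases hS : S u w = 0
      · rw [hS, zero_mul]
      · have hw := (h u w hS).2
        rw [Matrix.mul_apply, Finset.sum_eq_single (digits d q W w)]
        · simp [digitMatrix, hw]
        · intro z _ hz
          simp [digitMatrix, Ne.symm hz]
        · simp
    · intro z _ hz
      by_cases hS : S u z = 0
      · rw [hS, zero_mul]
      · have hzW := (h u z hS).2
        rw [Matrix.mul_apply, Finset.sum_eq_zero, mul_zero]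
        intro y _
        simp only [digitMatrix, Matrix.of_apply, Matrix.transpose_apply]
        split_ifs with h₁ h₂
        · exact absurd (digits_injOn hW h₁.1 h₂.1 (h₁.2.trans h₂.2.symm)) hz
        all_goals simp
    · simp
  rw [e, e, e]
  calc _ = (digitMatrix F d q W).transpose *
        ((S * (digitMatrix F d q W * (digitMatrix F d q W).transpose)) * S') *
        digitMatrix F d q W := by rw [hJ]
    _ = _ := by simp only [Matrix.mul_assoc]

/-- Entries of a product by a bilinear algorithm for the high digits. -/
theorem toDigits_mul_apply (hW : W.card ≤ d * q) {S S' : Matrix (Fin n) (Fin n) F}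
    (h : SupportedOn W S) {M : ℕ} {α β γ : Fin d → Fin d → Fin M → F}
    (halg : ∀ (S T : Matrix (Fin d) (Fin d) F) (i j : Fin d),
      (S * T) i j = ∑ w, γ i j w * ((∑ k, ∑ l, α k l w * S k l) * ∑ k, ∑ l, β k l w * T k l))
    (a a' : Fin d) (b b' : Fin q) :
    toDigits d q W (S * S') (a, b) (a', b') =
      ∑ w, γ a a' w * ∑ c, (∑ k, ∑ l, α k l w * toDigits d q W S (k, b) (l, c)) *
        ∑ k, ∑ l, β k l w * toDigits d q W S' (k, c) (l, b') := by
  rw [toDigits_mul hW h, Matrix.mul_apply, Fintype.sum_prod_type_right]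
  -- The bilinear identity holds for the high digits at each fixed `c`. Moving the sum over `c`
  -- inside turns the `w`-th scalar product into a product of two `q × q` matrices, which one worker
  -- can perform.
  have e : (∑ w, γ a a' w * ∑ c, (∑ k, ∑ l, α k l w * toDigits d q W S (k, b) (l, c)) *
        ∑ k, ∑ l, β k l w * toDigits d q W S' (k, c) (l, b')) =
      ∑ c, ∑ w, γ a a' w * ((∑ k, ∑ l, α k l w * toDigits d q W S (k, b) (l, c)) *
        ∑ k, ∑ l, β k l w * toDigits d q W S' (k, c) (l, b')) := by
    rw [Finset.sum_comm]
    exact Finset.sum_congr rfl fun w _ => Finset.mul_sum _ _ _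
  rw [e]
  refine Finset.sum_congr rfl fun c _ => ?_
  have := halg (Matrix.of fun k l => toDigits d q W S (k, b) (l, c))
    (Matrix.of fun k l => toDigits d q W S' (k, c) (l, b')) a a'
  rw [Matrix.mul_apply] at this
  simpa only [Matrix.of_apply] using this

theorem toDigits_congr {S S' : Matrix (Fin n) (Fin n) F} {y z : Fin d × Fin q}
    (h : ∀ u w, u ∈ W → w ∈ W → digits d q W u = y → digits d q W w = z → S u w = S' u w) :
    toDigits d q W S y z = toDigits d q W S' y z := by
  simp only [toDigits, Matrix.of_apply]
  refine Finset.sum_congr rfl fun u _ => Finset.sum_congr rfl fun w _ => ?_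
  simp only [digitMatrix, Matrix.of_apply]
  split_ifs with h₁ h₂
  · rw [h u w h₁.1 h₂.1 h₁.2 h₂.2]
  all_goals simp

end Digits

/-! ### Knowledge about distributed matrices -/

section Knowledge

variable {n m r : ℕ} {Ω I J E Y F : Type}

/-- The vertex `loc ω e` knows that it is the place of the item `e` and knows the datum of `e`. -/
def HoldsAt (S : Ω → Fin n → I) (A : Ω → Set E) (loc : Ω → E → Fin n) (dat : Ω → E → Y) : Prop :=
  ∀ ω ω' v, S ω v = S ω' v → ∀ e ∈ A ω, loc ω e = v →
    e ∈ A ω' ∧ loc ω' e = v ∧ dat ω' e = dat ω e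

/-- The owner of each label `(x, y, i)` knows the set `U i`. -/
def KnowsFamily (own : Fin m × Fin m × Fin r → Fin n) (U : Ω → Fin r → Finset (Fin n))
    (S : Ω → Fin n → I) : Prop :=
  ∀ ω ω' L, S ω (own L) = S ω' (own L) → U ω L.2.2 = U ω' L.2.2

/-- The owner of each label `(x, y, i)` knows the block of the `i`-th matrix at `(x, y)`. -/
def KnowsBlocks (own : Fin m × Fin m × Fin r → Fin n) (U : Ω → Fin r → Finset (Fin n))
    (B : Ω → Fin r → Matrix (Fin n) (Fin n) F) (S : Ω → Fin n → I) : Prop :=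
  ∀ ω ω' L, S ω (own L) = S ω' (own L) → ∀ u w, InPart (U ω L.2.2) m L.1 u →
    InPart (U ω L.2.2) m L.2.1 w → B ω L.2.2 u w = B ω' L.2.2 u w

variable {own : Fin m × Fin m × Fin r → Fin n} {U : Ω → Fin r → Finset (Fin n)}
  {B : Ω → Fin r → Matrix (Fin n) (Fin n) F} {S : Ω → Fin n → I} {S' : Ω → Fin n → J}
  {A : Ω → Set E} {loc : Ω → E → Fin n} {dat : Ω → E → Y}

theorem Determines.trans {K : Type} {S'' : Ω → Fin n → K} (h : Determines S'' S')
    (h' : Determines S' S) : Determines S'' S :=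
  fun ω ω' v e => h' ω ω' v (h ω ω' v e)

theorem KnowsFamily.of_determines (h : KnowsFamily own U S) (hd : Determines S' S) :
    KnowsFamily own U S' :=
  fun ω ω' L e => h ω ω' L (hd ω ω' _ e)

theorem KnowsBlocks.of_determines (h : KnowsBlocks own U B S) (hd : Determines S' S) :
    KnowsBlocks own U B S' :=
  fun ω ω' L e => h ω ω' L (hd ω ω' _ e)

/-- Routing, in terms of knowledge. -/
theorem HoldsAt.route [Finite E] [Finite Y] [Nonempty I] (hn : 2 ≤ n) {src dst : Ω → E → Fin n}
    (h : HoldsAt S A src fun ω e => (dst ω e, dat ω e)) {b L : ℕ}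
    (hcard : Nat.card (E × Y) ≤ n ^ b)
    (hsrc : ∀ ω v, {e | e ∈ A ω ∧ src ω e = v}.ncard ≤ L * n)
    (hdst : ∀ ω v, {e | e ∈ A ω ∧ dst ω e = v}.ncard ≤ L * n) :
    ∃ (J : Type) (_ : Nonempty J) (S' : Ω → Fin n → J),
      Solves S S' (128 * (L + 5) * (b + 10)) ∧ Determines S' S ∧ HoldsAt S' A dst dat := by
  refine ⟨_, inferInstance, _, Solves.route (val := dat) hn hcard hsrc hdst ?_, ?_, ?_⟩
  · intro ω ω' v e m hm hv
    obtain ⟨h₁, h₂, h₃⟩ := h ω ω' v e m hm hv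
    simp only [Prod.mk.injEq] at h₃
    exact ⟨h₁, h₂, h₃⟩
  · intro ω ω' v e
    exact congrArg Prod.fst e
  · intro ω ω' v e m hm hv
    have h₂ := congrArg Prod.snd e
    simp only at h₂
    have h₃ : (m, dat ω m) ∈ {p : E × Y | p.1 ∈ A ω' ∧ dst ω' p.1 = v ∧ dat ω' p.1 = p.2} :=
      h₂ ▸ ⟨hm, hv, rfl⟩
    exact h₃

end Knowledge

/-! ### Communication loads during a multiplication. -/

section Loads

variable {n m r : ℕ} [NeZero m] {own : Fin m × Fin m × Fin r → Fin n}

/-- The owner of the `j`-th label of the group `i`, where the labels of a group are numbered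
cyclically. -/
def worker (own : Fin m × Fin m × Fin r → Fin n) (j : ℕ) (i : Fin r) : Fin n :=
  own (⟨j / m % m, Nat.mod_lt _ (NeZero.pos m)⟩, ⟨j % m, Nat.mod_lt _ (NeZero.pos m)⟩, i)

theorem worker_injective_group (hown : Function.Injective own) {j j' : ℕ} {i i' : Fin r}
    (h : worker own j i = worker own j' i') : i = i' ∧ j % m = j' % m ∧ j / m % m = j' / m % m := by
  have := hown h
  simp only [Prod.mk.injEq, Fin.mk.injEq] at this
  exact ⟨this.2.2, this.2.1, this.1⟩

/-- A vertex owns at most one label, which fixes the group `i` and the task number modulo `m * m`.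
-/
theorem ncard_worker_le (hown : Function.Injective own) (Q : ℕ) (v : Fin n) :
    {p : Fin r × Fin Q | worker own p.2 p.1 = v}.ncard ≤ Q / (m * m) + 1 := by
  have h : {p : Fin r × Fin Q | worker own p.2 p.1 = v}.ncard ≤
      (Finset.range (Q / (m * m) + 1) : Set ℕ).ncard := by
    refine Set.ncard_le_ncard_of_injOn (fun p => p.2 / m / m) ?_ ?_ (Finset.finite_toSet _)
    · rintro p -
      simp only [Finset.coe_range, Set.mem_Iio, Nat.div_div_eq_div_mul]
      exact Nat.lt_succ_of_le (Nat.div_le_div_right p.2.2.le)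
    · rintro ⟨i, j⟩ hp ⟨i', j'⟩ hp' h
      obtain ⟨h₁, h₂, h₃⟩ := worker_injective_group hown (hp.trans hp'.symm)
      simp only at h h₁ h₂ h₃
      refine Prod.ext h₁ (Fin.ext ?_)
      simp only
      rw [← Nat.div_add_mod (j : ℕ) m, ← Nat.div_add_mod (j' : ℕ) m, h₂,
        ← Nat.div_add_mod ((j : ℕ) / m) m, ← Nat.div_add_mod ((j' : ℕ) / m) m, h, h₃]
  rwa [Set.ncard_coe_finset, Finset.card_range] at h

/-- The owner of the label of the block at `(u, w)`, where `e = (i, _, u, w)`. -/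
noncomputable def owner (own : Fin m × Fin m × Fin r → Fin n) (V : Fin r → Finset (Fin n))
    (e : Fin r × Bool × Fin n × Fin n) : Fin n :=
  own (part m (V e.1) e.2.2.1, part m (V e.1) e.2.2.2, e.1)

/-- The vertex which collects the entries whose low digits are those of `(u, w)`, where
`e = (i, _, u, w)`. -/
def collector (own : Fin m × Fin m × Fin r → Fin n) (d q : ℕ) [NeZero d] [NeZero q]
    (V : Fin r → Finset (Fin n)) (e : Fin r × Bool × Fin n × Fin n) : Fin n :=
  worker own (finProdFinEquiv ((digits d q (V e.1) e.2.2.1).2, (digits d q (V e.1) e.2.2.2).2)) e.1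

/-- The places of the entries of the matrices on the sets `V i`. -/
def entries (V : Fin r → Finset (Fin n)) : Set (Fin r × Bool × Fin n × Fin n) :=
  {e | e.2.2.1 ∈ V e.1 ∧ e.2.2.2 ∈ V e.1}

/-- All entries owned by `v` lie in one block, as `v` has at most one label; the factor two counts
the Boolean flag. -/
theorem ncard_owner_le (hown : Function.Injective own) (V : Fin r → Finset (Fin n)) {β : ℕ}
    (hβ : ∀ i x, {u | InPart (V i) m x u}.ncard ≤ β) (v : Fin n) :
    {e | e ∈ entries V ∧ owner own V e = v}.ncard ≤ 2 * β ^ 2 := by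
  rcases Set.eq_empty_or_nonempty {e | e ∈ entries V ∧ owner own V e = v} with h | ⟨e₀, he₀⟩
  · rw [h, Set.ncard_empty]; exact Nat.zero_le _
  · have key : ∀ e, e ∈ {e | e ∈ entries V ∧ owner own V e = v} → e.1 = e₀.1 ∧
        InPart (V e₀.1) m (part m (V e₀.1) e₀.2.2.1) e.2.2.1 ∧
        InPart (V e₀.1) m (part m (V e₀.1) e₀.2.2.2) e.2.2.2 := by
      rintro ⟨i, t, u, w⟩ he
      have h := hown (he.2.trans he₀.2.symm)
      simp only [Prod.mk.injEq] at h
      obtain ⟨h₁, h₂, h₃⟩ := h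
      have he' := he.1
      subst h₃
      refine ⟨rfl, ?_, ?_⟩
      · rw [← h₁]
        exact inPart_part he'.1
      · rw [← h₂]
        exact inPart_part he'.2
    refine (Set.ncard_le_ncard_of_injOn (fun e => e.2)
      (t := (Set.univ : Set Bool) ×ˢ ({u | InPart (V e₀.1) m (part m (V e₀.1) e₀.2.2.1) u} ×ˢ
        {u | InPart (V e₀.1) m (part m (V e₀.1) e₀.2.2.2) u})) ?_ ?_).trans ?_
    · intro e he
      exact ⟨Set.mem_univ _, (key e he).2⟩
    · intro e he e' he' h
      exact Prod.ext ((key e he).1.trans (key e' he').1.symm) h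
    · rw [Set.ncard_prod, Set.ncard_prod, Set.ncard_univ, pow_two]
      simp only [Nat.card_eq_fintype_card, Fintype.card_bool]
      exact Nat.mul_le_mul_left _ (Nat.mul_le_mul (hβ _ _) (hβ _ _))

/-- A collector serves at most `q * q / (m * m) + 1` pairs of low digits, and for each pair the high
digits leave at most `d ^ 2` entries per flag. -/
theorem ncard_collector_le (hown : Function.Injective own) (V : Fin r → Finset (Fin n)) {d q : ℕ}
    [NeZero d] [NeZero q] (hV : ∀ i, (V i).card ≤ d * q) (v : Fin n) :
    {e | e ∈ entries V ∧ collector own d q V e = v}.ncard ≤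
      (q * q / (m * m) + 1) * (2 * d ^ 2) := by
  refine (ncard_le_mul_of_maps _ {p : Fin r × Fin (q * q) | worker own p.2 p.1 = v}
    (fun e => (e.1, finProdFinEquiv
      ((digits d q (V e.1) e.2.2.1).2, (digits d q (V e.1) e.2.2.2).2))) (2 * d ^ 2) ?_ ?_).trans
    (Nat.mul_le_mul_right _ (ncard_worker_le hown _ v))
  · rintro e ⟨-, he⟩
    exact he
  · rintro ⟨i, p⟩ -
    obtain ⟨⟨b, b'⟩, rfl⟩ := finProdFinEquiv.surjective p
    refine (Set.ncard_le_ncard_of_injOn (fun e => e.2)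
      (t := (Set.univ : Set Bool) ×ˢ ({u | u ∈ V i ∧ (digits d q (V i) u).2 = b} ×ˢ
        {u | u ∈ V i ∧ (digits d q (V i) u).2 = b'})) ?_ ?_).trans ?_
    · rintro ⟨i', t, u, w⟩ ⟨⟨⟨h₁, h₂⟩, -⟩, h₃⟩
      simp only [Prod.mk.injEq, EmbeddingLike.apply_eq_iff_eq] at h₁ h₂ h₃
      obtain ⟨rfl, h₃, h₄⟩ := h₃
      exact ⟨Set.mem_univ _, ⟨h₁, h₃⟩, ⟨h₂, h₄⟩⟩
    · rintro e ⟨-, he⟩ e' ⟨-, he'⟩ h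
      exact Prod.ext ((congrArg Prod.fst he).trans (congrArg Prod.fst he').symm) h
    · rw [Set.ncard_prod, Set.ncard_prod, Set.ncard_univ, pow_two]
      simp only [Nat.card_eq_fintype_card, Fintype.card_bool]
      exact Nat.mul_le_mul_left _ (Nat.mul_le_mul (ncard_lowDigit_le (hV i) b)
        (ncard_lowDigit_le (hV i) b'))

theorem ncard_combinations_le (hown : Function.Injective own) (q M : ℕ) (v : Fin n) :
    {e : Fin r × Bool × (Fin q × Fin q) × Fin M |
      worker own (finProdFinEquiv e.2.2.1) e.1 = v}.ncard ≤
      (q * q / (m * m) + 1) * (2 * M) := by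
  refine (ncard_le_mul_of_maps _ {p : Fin r × Fin (q * q) | worker own p.2 p.1 = v}
    (fun e => (e.1, finProdFinEquiv e.2.2.1)) (2 * M) ?_ ?_).trans
    (Nat.mul_le_mul_right _ (ncard_worker_le hown _ v))
  · intro e he
    exact he
  · rintro ⟨i, p⟩ -
    refine (Set.ncard_le_ncard_of_injOn (fun e => (e.2.1, e.2.2.2))
      (t := (Set.univ : Set (Bool × Fin M))) (fun _ _ => Set.mem_univ _) ?_).trans ?_
    · rintro e ⟨-, he⟩ e' ⟨-, he'⟩ h
      simp only [Prod.mk.injEq] at he he' h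
      have := finProdFinEquiv.injective (he.2.trans he'.2.symm)
      exact Prod.ext (he.1.trans he'.1.symm) (Prod.ext h.1 (Prod.ext this h.2))
    · rw [Set.ncard_univ]; simp

theorem ncard_products_le (hown : Function.Injective own) (q M : ℕ) (v : Fin n) :
    {e : Fin r × Bool × (Fin q × Fin q) × Fin M | worker own e.2.2.2 e.1 = v}.ncard ≤
      (M / (m * m) + 1) * (2 * (q * q)) := by
  refine (ncard_le_mul_of_maps _ {p : Fin r × Fin M | worker own p.2 p.1 = v}
    (fun e => (e.1, e.2.2.2)) (2 * (q * q)) ?_ ?_).trans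
    (Nat.mul_le_mul_right _ (ncard_worker_le hown _ v))
  · intro e he
    exact he
  · rintro ⟨i, p⟩ -
    refine (Set.ncard_le_ncard_of_injOn (fun e => (e.2.1, e.2.2.1))
      (t := (Set.univ : Set (Bool × Fin q × Fin q))) (fun _ _ => Set.mem_univ _) ?_).trans ?_
    · rintro e ⟨-, he⟩ e' ⟨-, he'⟩ h
      simp only [Prod.mk.injEq] at he he' h
      exact Prod.ext (he.1.trans he'.1.symm) (Prod.ext h.1 (Prod.ext h.2 (he.2.trans he'.2.symm)))
    · rw [Set.ncard_univ]; simp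

end Loads

/-! ### Multiplication and powers of distributed matrices. -/

/-- The matrices `B i * B' i` are computed from the distributed matrices `B i` and `B' i` by a
bilinear algorithm. -/
theorem KnowsBlocks.exists_mul {n m r d q M β L b : ℕ} [NeZero m] [NeZero d] [NeZero q] (hn : 2 ≤ n)
    {F : Type} [Field F] [Fintype F] {Ω I : Type} [Nonempty I]
    {own : Fin m × Fin m × Fin r → Fin n} (hown : Function.Injective own)
    {U : Ω → Fin r → Finset (Fin n)} {B B' : Ω → Fin r → Matrix (Fin n) (Fin n) F}
    {S : Ω → Fin n → I} (hU : KnowsFamily own U S) (hB : KnowsBlocks own U B S)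
    (hB' : KnowsBlocks own U B' S) (hsupp : ∀ ω i, SupportedOn (U ω i) (B ω i))
    (hcard : ∀ ω i, (U ω i).card ≤ d * q)
    (hβ : ∀ ω i x, {u | InPart (U ω i) m x u}.ncard ≤ β) (halg : HasBilinearAlgorithm F d M)
    (h₁ : 2 * β ^ 2 ≤ L * n) (h₂ : (q * q / (m * m) + 1) * (2 * d ^ 2) ≤ L * n)
    (h₃ : (q * q / (m * m) + 1) * (2 * M) ≤ L * n)
    (h₄ : (M / (m * m) + 1) * (2 * (q * q)) ≤ L * n)
    (hc₁ : r * (2 * (n * n)) * Fintype.card F ≤ n ^ b)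
    (hc₂ : r * (2 * (q * q * M)) * Fintype.card F ≤ n ^ b) :
    ∃ (J : Type) (_ : Nonempty J) (S' : Ω → Fin n → J),
      Solves S S' (4 * (128 * (L + 5) * (b + 10))) ∧ Determines S' S ∧
        KnowsBlocks own U (fun ω i => B ω i * B' ω i) S' := by
  classical
  obtain ⟨α, α', γ, halg⟩ := halg
  have hE₁ : Nat.card ((Fin r × Bool × Fin n × Fin n) × F) ≤ n ^ b := by
    refine le_trans (le_of_eq ?_) hc₁
    simp
  have hE₂ : Nat.card ((Fin r × Bool × (Fin q × Fin q) × Fin M) × F) ≤ n ^ b := by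
    refine le_trans (le_of_eq ?_) hc₂
    simp
  -- the entries are sent from the owners of the blocks to the collectors
  let val₁ : Ω → Fin r × Bool × Fin n × Fin n → F := fun ω e =>
    (if e.2.1 then B' ω e.1 else B ω e.1) e.2.2.1 e.2.2.2
  have k₁ : HoldsAt S (fun ω => entries (U ω)) (fun ω => owner own (U ω))
      (fun ω e => (collector own d q (U ω) e, val₁ ω e)) := by
    rintro ω ω' v hS ⟨i, t, u, w⟩ he rfl
    have hUi : U ω i = U ω' i := hU ω ω' _ hS
    refine ⟨?_, ?_, ?_⟩
    · simpa only [entries, Set.mem_ofPred_eq, hUi] using he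
    · simp only [owner, hUi]
    · refine Prod.ext ?_ ?_
      · simp only [collector, hUi]
      · have e₁ := hB ω ω' _ hS u w (inPart_part he.1) (inPart_part he.2)
        have e₂ := hB' ω ω' _ hS u w (inPart_part he.1) (inPart_part he.2)
        cases t
        · exact e₁.symm
        · exact e₂.symm
  obtain ⟨J₁, _, S₁, hs₁, hd₁, k₁⟩ := k₁.route hn hE₁
    (fun ω v => (ncard_owner_le hown (U ω) (hβ ω) v).trans h₁)
    (fun ω v => (ncard_collector_le hown (U ω) (hcard ω) v).trans h₂)
  -- the linear combinations are sent from the collectors to the workers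
  let val₂ : Ω → Fin r × Bool × (Fin q × Fin q) × Fin M → F := fun ω e =>
    ∑ k, ∑ l, (if e.2.1 then α' else α) k l e.2.2.2 *
      toDigits d q (U ω e.1) (if e.2.1 then B' ω e.1 else B ω e.1) (k, e.2.2.1.1) (l, e.2.2.1.2)
  let col : Ω → Fin r × Bool × (Fin q × Fin q) × Fin M → Fin n := fun _ e =>
    worker own (finProdFinEquiv e.2.2.1) e.1
  let wrk : Ω → Fin r × Bool × (Fin q × Fin q) × Fin M → Fin n := fun _ e =>
    worker own e.2.2.2 e.1
  have k₂ : HoldsAt S₁ (fun _ => Set.univ) col (fun ω e => (wrk ω e, val₂ ω e)) := by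
    rintro ω ω' v hS ⟨i, t, p, z⟩ - rfl
    have hUi : U ω i = U ω' i := hU ω ω' _ (hd₁ ω ω' _ hS)
    refine ⟨Set.mem_univ _, rfl, Prod.ext rfl ?_⟩
    change val₂ ω' _ = val₂ ω _
    refine Finset.sum_congr rfl fun k _ => Finset.sum_congr rfl fun l _ => ?_
    simp only [← hUi]
    congr 1
    -- A linear combination at the low digits `p` involves only entries with exactly these low
    -- digits, and all of them have arrived at the same collector.
    refine toDigits_congr fun u w hu hw hku hlw => ?_
    refine (k₁ ω ω' _ hS (i, t, u, w) ⟨hu, hw⟩ ?_).2.2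
    simp only [collector, hku, hlw, col]
  obtain ⟨J₂, _, S₂, hs₂, hd₂, k₂⟩ := k₂.route hn hE₂
    (fun ω v => le_trans (Set.ncard_le_ncard fun e he => he.2)
      ((ncard_combinations_le hown q M v).trans h₃))
    (fun ω v => le_trans (Set.ncard_le_ncard fun e he => he.2)
      ((ncard_products_le hown q M v).trans h₄))
  -- the products are sent from the workers to the collectors
  let val₃ : Ω → Fin r × Bool × (Fin q × Fin q) × Fin M → F := fun ω e =>
    ∑ c, val₂ ω (e.1, false, (e.2.2.1.1, c), e.2.2.2) * val₂ ω (e.1, true, (c, e.2.2.1.2), e.2.2.2)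
  -- From here on the Boolean flag distinguishes nothing: it is kept so that the index types and
  -- load bounds apply again, and only the copies flagged `true` are read.
  have k₃ : HoldsAt S₂ (fun _ => Set.univ) wrk (fun ω e => (col ω e, val₃ ω e)) := by
    rintro ω ω' v hS ⟨i, t, p, z⟩ - rfl
    refine ⟨Set.mem_univ _, rfl, Prod.ext rfl ?_⟩
    change val₃ ω' _ = val₃ ω _
    refine Finset.sum_congr rfl fun c _ => ?_
    rw [(k₂ ω ω' _ hS (i, false, (p.1, c), z) (Set.mem_univ _) rfl).2.2,
      (k₂ ω ω' _ hS (i, true, (c, p.2), z) (Set.mem_univ _) rfl).2.2]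
  obtain ⟨J₃, _, S₃, hs₃, hd₃, k₃⟩ := k₃.route hn hE₂
    (fun ω v => le_trans (Set.ncard_le_ncard fun e he => he.2)
      ((ncard_products_le hown q M v).trans h₄))
    (fun ω v => le_trans (Set.ncard_le_ncard fun e he => he.2)
      ((ncard_combinations_le hown q M v).trans h₃))
  -- the entries of the products are sent from the collectors to the owners of the blocks
  let val₄ : Ω → Fin r × Bool × Fin n × Fin n → F := fun ω e =>
    (B ω e.1 * B' ω e.1) e.2.2.1 e.2.2.2
  have hval₄ : ∀ ω i u w, u ∈ U ω i → w ∈ U ω i → (B ω i * B' ω i) u w =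
      ∑ z, γ (digits d q (U ω i) u).1 (digits d q (U ω i) w).1 z *
        val₃ ω (i, true, ((digits d q (U ω i) u).2, (digits d q (U ω i) w).2), z) := by
    intro ω i u w hu hw
    rw [← toDigits_apply_digits (hcard ω i) (B ω i * B' ω i) hu hw]
    exact toDigits_mul_apply (hcard ω i) (hsupp ω i) halg _ _ _ _
  have hd₃' := hd₃.trans (hd₂.trans hd₁)
  have k₄ : HoldsAt S₃ (fun ω => entries (U ω)) (fun ω => collector own d q (U ω))
      (fun ω e => (owner own (U ω) e, val₄ ω e)) := by
    rintro ω ω' v hS ⟨i, t, u, w⟩ he rfl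
    have hUi : U ω i = U ω' i := hU ω ω' _ (hd₃' ω ω' _ hS)
    refine ⟨?_, ?_, ?_⟩
    · simpa only [entries, Set.mem_ofPred_eq, hUi] using he
    · simp only [collector, hUi]
    · refine Prod.ext ?_ ?_
      · simp only [owner, hUi]
      · simp only [val₄]
        rw [hval₄ ω i u w he.1 he.2, hval₄ ω' i u w (hUi ▸ he.1) (hUi ▸ he.2)]
        simp only [← hUi]
        refine Finset.sum_congr rfl fun z _ => ?_
        rw [(k₃ ω ω' _ hS (i, true, ((digits d q (U ω i) u).2, (digits d q (U ω i) w).2), z)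
          (Set.mem_univ _) rfl).2.2]
  obtain ⟨J₄, _, S₄, hs₄, hd₄, k₄⟩ := k₄.route hn hE₁
    (fun ω v => (ncard_collector_le hown (U ω) (hcard ω) v).trans h₂)
    (fun ω v => (ncard_owner_le hown (U ω) (hβ ω) v).trans h₁)
  refine ⟨J₄, ‹_›, S₄, (((hs₁.comp hs₂).comp hs₃).comp hs₄).mono (le_of_eq (by ring)),
    hd₄.trans hd₃', ?_⟩
  rintro ω ω' ⟨x, y, i⟩ hS u w hu hw
  refine (k₄ ω ω' _ hS (i, true, u, w) ⟨hu.1, hw.1⟩ ?_).2.2.symm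
  simp only [owner]
  rw [hu.part_eq, hw.part_eq]

/-- Powers of distributed matrices by repeated squaring. -/
theorem KnowsBlocks.exists_pow {n m r d q M β L b : ℕ} [NeZero m] [NeZero d] [NeZero q] (hn : 2 ≤ n)
    {F : Type} [Field F] [Fintype F] {Ω I : Type} [Nonempty I]
    {own : Fin m × Fin m × Fin r → Fin n} (hown : Function.Injective own)
    {U : Ω → Fin r → Finset (Fin n)} {B : Ω → Fin r → Matrix (Fin n) (Fin n) F}
    {S : Ω → Fin n → I} (hU : KnowsFamily own U S) (hB : KnowsBlocks own U B S)
    (hsupp : ∀ ω i, SupportedOn (U ω i) (B ω i))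
    (hcard : ∀ ω i, (U ω i).card ≤ d * q)
    (hβ : ∀ ω i x, {u | InPart (U ω i) m x u}.ncard ≤ β) (halg : HasBilinearAlgorithm F d M)
    (h₁ : 2 * β ^ 2 ≤ L * n) (h₂ : (q * q / (m * m) + 1) * (2 * d ^ 2) ≤ L * n)
    (h₃ : (q * q / (m * m) + 1) * (2 * M) ≤ L * n)
    (h₄ : (M / (m * m) + 1) * (2 * (q * q)) ≤ L * n)
    (hc₁ : r * (2 * (n * n)) * Fintype.card F ≤ n ^ b)
    (hc₂ : r * (2 * (q * q * M)) * Fintype.card F ≤ n ^ b) (h : ℕ) (hh : 0 < h) :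
    ∃ (J : Type) (_ : Nonempty J) (S' : Ω → Fin n → J),
      Solves S S' (2 * Nat.log 2 h * (4 * (128 * (L + 5) * (b + 10)))) ∧ Determines S' S ∧
        KnowsBlocks own U (fun ω i => B ω i ^ h) S' := by
  -- Positive exponents are needed because the identity matrix is in general not supported on `U ω
  -- i`.
  have hsuppow : ∀ k, 0 < k → ∀ ω i, SupportedOn (U ω i) (B ω i ^ k) := by
    intro k hk ω i
    induction k, hk using Nat.le_induction with
    | base => rw [pow_one]; exact hsupp ω i
    | succ k _ ih => rw [pow_succ]; exact ih.mul (hsupp ω i)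
  set T := 4 * (128 * (L + 5) * (b + 10)) with hT
  induction h using Nat.strong_induction_on with
  | _ h ih =>
    rcases Nat.lt_or_ge h 2 with h2 | h2
    · obtain rfl : h = 1 := by omega
      exact ⟨I, inferInstance, S, (Solves.idle S 0).mono (Nat.zero_le _), fun _ _ _ e => e,
        by simpa only [pow_one] using hB⟩
    · have hhalf : 0 < h / 2 := by omega
      -- Halving the exponent costs one squaring and, if `h` is odd, one further multiplication by
      -- `B`: at most two products per unit of `Nat.log 2 h`.
      obtain ⟨J₁, _, S₁, hs₁, hd₁, k₁⟩ := ih (h / 2) (by omega) hhalf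
      obtain ⟨J₂, _, S₂, hs₂, hd₂, k₂⟩ := KnowsBlocks.exists_mul hn hown (hU.of_determines hd₁) k₁ k₁
        (hsuppow _ hhalf) hcard hβ halg h₁ h₂ h₃ h₄ hc₁ hc₂
      have hlog : Nat.log 2 h = Nat.log 2 (h / 2) + 1 := Nat.log_of_one_lt_of_le (by norm_num) h2
      have hd₂' := hd₂.trans hd₁
      rcases Nat.even_or_odd h with he | ho
      · refine ⟨J₂, ‹_›, S₂, (hs₁.comp hs₂).mono ?_, hd₂', ?_⟩
        · exact (Nat.le_add_right _ T).trans (le_of_eq (by rw [hlog]; ring))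
        · have : h / 2 + h / 2 = h := by obtain ⟨k, rfl⟩ := he; omega
          simpa only [← pow_add, this] using k₂
      · obtain ⟨J₃, _, S₃, hs₃, hd₃, k₃⟩ := KnowsBlocks.exists_mul hn hown
          (hU.of_determines hd₂') k₂ (hB.of_determines hd₂')
          (fun ω i => (hsuppow _ hhalf ω i).mul (hsuppow _ hhalf ω i)) hcard hβ halg h₁ h₂ h₃ h₄
          hc₁ hc₂
        refine ⟨J₃, ‹_›, S₃, ((hs₁.comp hs₂).comp hs₃).mono ?_, hd₃.trans hd₂', ?_⟩
        · exact le_of_eq (by rw [hlog]; ring)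
        · have : h / 2 + h / 2 + 1 = h := by obtain ⟨k, rfl⟩ := ho; omega
          simpa only [← pow_add, ← pow_succ, this] using k₃

/-! ### Distribution of the input -/

section Input

variable {n r : ℕ}

instance : Nonempty (LocalInput n r) := ⟨⟨∅, ∅, none⟩⟩

theorem IsLabelling.exists_owner {ℓ : Fin n → Option (Label n r)} (h : IsLabelling ℓ) :
    ∃ own : Label n r → Fin n, Function.Injective own ∧ ∀ v L, ℓ v = some L ↔ v = own L := by
  choose own h₁ h₂ using h
  refine ⟨own, fun L L' hL => ?_, fun v L => ⟨h₂ L v, ?_⟩⟩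
  · have := h₁ L
    simp only at this
    rw [hL, h₁ L'] at this
    exact (Option.some.inj this).symm
  · rintro rfl
    exact h₁ L

theorem gridSize_mul_le (n r : ℕ) : gridSize n r * gridSize n r * r ≤ n :=
  (Nat.mul_le_mul_right r (Nat.sqrt_le (n / r))).trans (Nat.div_mul_le_self n r)

theorem ncard_row_le {D k : ℕ} (V : Fin r → Finset (Fin n)) (v : Fin n)
    (hD : {i | v ∈ V i}.ncard ≤ D) (hk : ∀ i, (V i).card ≤ k) :
    {e | e ∈ entries V ∧ e.2.2.1 = v}.ncard ≤ D * (2 * k) := by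
  refine (ncard_le_mul_of_maps _ {i | v ∈ V i} (fun e => e.1) (2 * k) ?_ ?_).trans
    (Nat.mul_le_mul_right _ hD)
  · rintro e ⟨he, rfl⟩
    exact he.1
  · rintro i -
    refine (Set.ncard_le_ncard_of_injOn (fun e => (e.2.1, e.2.2.2))
      (t := (Set.univ : Set Bool) ×ˢ (V i : Set (Fin n))) ?_ ?_).trans ?_
    · rintro e ⟨⟨he, -⟩, rfl⟩
      exact ⟨Set.mem_univ _, he.2⟩
    · rintro e ⟨⟨-, he⟩, hi⟩ e' ⟨⟨-, he'⟩, hi'⟩ h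
      simp only [Prod.mk.injEq] at h
      exact Prod.ext (hi.trans hi'.symm) (Prod.ext h.1 (Prod.ext (he.trans he'.symm) h.2))
    · rw [Set.ncard_prod, Set.ncard_univ, Set.ncard_coe_finset]
      simp only [Nat.card_eq_fintype_card, Fintype.card_bool]
      exact Nat.mul_le_mul_left _ (hk i)

open Classical in
/-- The adjacency matrix of `G[W]` with zero rows and columns for the other vertices. -/
noncomputable def extendedAdjMatrix (F : Type) [Field F] (G : Digraph (Fin n))
    (W : Finset (Fin n)) : Matrix (Fin n) (Fin n) F :=
  Matrix.of fun u w => if u ∈ W ∧ w ∈ W ∧ G.Adj u w then 1 else 0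

theorem supportedOn_extendedAdjMatrix (F : Type) [Field F] (G : Digraph (Fin n))
    (W : Finset (Fin n)) : SupportedOn W (extendedAdjMatrix F G W) := by
  intro u w h
  simp only [extendedAdjMatrix, Matrix.of_apply, ne_eq, ite_eq_right_iff, one_ne_zero] at h
  by_contra hne
  exact h fun h' => hne ⟨h'.1, h'.2.1⟩

/-- Summands with an intermediate vertex outside `W` vanish. Only entries inside `W` are compared,
so the exponent `0` is covered as well. -/
theorem inducedAdjMatrix_pow_apply (F : Type) [Field F] (G : Digraph (Fin n)) (W : Finset (Fin n))
    (h : ℕ) (u w : W) : (inducedAdjMatrix F G W ^ h) u w = (extendedAdjMatrix F G W ^ h) u w := by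
  classical
  induction h generalizing w with
  | zero =>
    rw [pow_zero, pow_zero, Matrix.one_apply, Matrix.one_apply]
    simp only [Subtype.ext_iff]
  | succ h ih =>
    rw [pow_succ, pow_succ, Matrix.mul_apply, Matrix.mul_apply]
    have h₁ : ∀ z, z ∉ W → (extendedAdjMatrix F G W ^ h) u z * extendedAdjMatrix F G W z w = 0 := by
      intro z hz
      simp [extendedAdjMatrix, hz]
    rw [← Finset.sum_subset (Finset.subset_univ W) fun z _ hz => h₁ z hz,
      ← Finset.sum_coe_sort W]
    refine Finset.sum_congr rfl fun z _ => ?_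
    rw [ih z]
    congr 1
    simp [extendedAdjMatrix, inducedAdjMatrix]

theorem block_pow_eq {F : Type} [Field F] {G G' : Digraph (Fin n)} {W W' : Finset (Fin n)}
    {h m x y : ℕ} (hW : W = W') (hblock : ∀ u w, InPart W m x u → InPart W m y w →
      (extendedAdjMatrix F G W ^ h) u w = (extendedAdjMatrix F G' W' ^ h) u w) :
    block (inducedAdjMatrix F G W ^ h) m x y = block (inducedAdjMatrix F G' W' ^ h) m x y := by
  subst hW
  funext u w
  simp only [block]
  split_ifs with hp
  · rw [inducedAdjMatrix_pow_apply, inducedAdjMatrix_pow_apply, hblock u w hp.1 hp.2]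
  · rfl

/-- The required output of a vertex whose label is `L`. -/
noncomputable def requiredOutput (F : Type) [Field F] (h : ℕ) (G : Digraph (Fin n))
    (U : Fin r → Finset (Fin n)) : Option (Label n r) → Fin n → Fin n → Option F
  | some (x, y, i) => block (inducedAdjMatrix F G (U i) ^ h) (gridSize n r) x y
  | none => fun _ _ => none

variable {Ω I : Type} {G : Ω → Digraph (Fin n)} {U : Ω → Fin r → Finset (Fin n)}

/-- There are at most `n` labels, so a label or its absence is one of `n + 1 ≤ n²` values and fits
into two words. Afterwards the labelling is common knowledge and can be fixed by `Solves.cases`. -/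
theorem Solves.exchangeLabels (hn : 2 ≤ n) (ℓ : Ω → Fin n → Option (Label n r)) :
    Solves (fun ω => localInput (G ω) (U ω) (ℓ ω))
      (fun ω v => (localInput (G ω) (U ω) (ℓ ω) v, ℓ ω)) 2 := by
  refine Solves.exchange (W := Option (Label n r)) 2 ?_ (fun ω u _ => ℓ ω u) ?_
  · have h₁ : Nat.card (Option (Label n r)) ≤ n + 1 := by
      simp only [Nat.card_eq_fintype_card, Fintype.card_option, Fintype.card_prod, Fintype.card_fin]
      have := gridSize_mul_le n r
      rw [← mul_assoc]
      omega
    have h₂ : n ≤ 2 ^ Nat.clog 2 n := Nat.le_pow_clog (by norm_num) n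
    rw [mul_comm, pow_mul]
    nlinarith
  · intro ω ω' v h
    have := congrArg LocalInput.label h
    funext _
    exact this

/-- The owner of `(x, y, i)` has no other label, so one bit from each vertex `u`, telling whether `u
∈ U i`, suffices. -/
theorem KnowsFamily.exists_of_membership (hn : 2 ≤ n) [Nonempty I] {inp : Ω → Fin n → I}
    (hinp : Determines inp fun ω v => {i | v ∈ U ω i}) {m : ℕ}
    {own : Fin m × Fin m × Fin r → Fin n} (hown : Function.Injective own) :
    ∃ (J : Type) (_ : Nonempty J) (S : Ω → Fin n → J),
      Solves inp S 1 ∧ Determines S inp ∧ KnowsFamily own U S := by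
  classical
  let msg : Ω → Fin n → Fin n → Bool := fun ω u v => decide (∃ L, v = own L ∧ u ∈ U ω L.2.2)
  refine ⟨_, inferInstance, _, Solves.exchange (W := Bool) 1 ?_ msg ?_, ?_, ?_⟩
  · have : 1 ≤ Nat.clog 2 n := Nat.clog_pos (by norm_num) hn
    simpa using Nat.pow_le_pow_right (n := 2) (by norm_num) this
  · intro ω ω' u h
    funext v
    have h' : ∀ i, u ∈ U ω i ↔ u ∈ U ω' i := fun i => Set.ext_iff.1 (hinp ω ω' u h) i
    simp only [msg, h']
  · exact fun ω ω' v h => congrArg Prod.fst h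
  · intro ω ω' L h
    ext u
    have h₁ := congrFun (congrArg Prod.snd h) u
    have h₂ : ∀ ω, (∃ L', own L = own L' ∧ u ∈ U ω L'.2.2) ↔ u ∈ U ω L.2.2 := by
      intro ω
      constructor
      · rintro ⟨L', hL, hu⟩
        rwa [hown hL]
      · exact fun hu => ⟨L, rfl, hu⟩
    simp only [msg, h₂, decide_eq_decide] at h₁
    exact h₁

/-- The owners of the labels learn the blocks of the adjacency matrices from the vertices. -/
theorem KnowsBlocks.exists_extendedAdjMatrix (hn : 2 ≤ n) (F : Type) [Field F] [Nonempty I]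
    {inp : Ω → Fin n → I} (hadj : Determines inp fun ω v => {w | (G ω).Adj v w}) {m D k β L b : ℕ} [NeZero m]
    {own : Fin m × Fin m × Fin r → Fin n} (hown : Function.Injective own)
    (hU : KnowsFamily own U inp) (hD : ∀ ω v, {i | v ∈ U ω i}.ncard ≤ D)
    (hk : ∀ ω i, (U ω i).card ≤ k) (hβ : ∀ ω i x, {u | InPart (U ω i) m x u}.ncard ≤ β)
    (h₁ : 2 * β ^ 2 ≤ L * n) (h₂ : D * (2 * k) ≤ L * n) (hc : r * (2 * (n * n)) * 2 ≤ n ^ b) :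
    ∃ (J : Type) (_ : Nonempty J) (S : Ω → Fin n → J),
      Solves inp S (2 * (128 * (L + 5) * (b + 10))) ∧ Determines S inp ∧
        KnowsBlocks own U (fun ω i => extendedAdjMatrix F (G ω) (U ω i)) S := by
  classical
  have hE : Nat.card ((Fin r × Bool × Fin n × Fin n) × Bool) ≤ n ^ b := by
    refine le_trans (le_of_eq ?_) hc
    simp
  have hE' : Nat.card ((Fin r × Bool × Fin n × Fin n) × Unit) ≤ n ^ b := by
    refine le_trans (le_trans (le_of_eq ?_) (Nat.le_mul_of_pos_right (r * (2 * (n * n)))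
      (Nat.two_pos))) hc
    simp
  -- A vertex cannot address its adjacency bits before it knows the sets `U i` containing it,
  -- because the owner of an entry depends on positions in `U i`. The owners first send tokens
  -- without content: the arrival of the token `(i, t, u, w)` tells `u` that `w ∈ U i`.
  have k₁ : HoldsAt inp (fun ω => entries (U ω)) (fun ω => owner own (U ω))
      (fun _ e => (e.2.2.1, ())) := by
    rintro ω ω' v hS ⟨i, t, u, w⟩ he rfl
    have hUi : U ω i = U ω' i := hU ω ω' _ hS
    refine ⟨?_, ?_, rfl⟩
    · simpa only [entries, Set.mem_ofPred_eq, hUi] using he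
    · simp only [owner, hUi]
  obtain ⟨J₁, _, S₁, hs₁, hd₁, k₁⟩ := k₁.route hn hE'
    (fun ω v => (ncard_owner_le hown (U ω) (hβ ω) v).trans h₁)
    (fun ω v => (ncard_row_le (U ω) v (hD ω v) (hk ω)).trans h₂)
  have k₂ : HoldsAt S₁ (fun ω => entries (U ω)) (fun _ e => e.2.2.1)
      (fun ω e => (owner own (U ω) e, decide ((G ω).Adj e.2.2.1 e.2.2.2))) := by
    rintro ω ω' v hS ⟨i, t, u, w⟩ he rfl
    have hUi : U ω i = U ω' i := by
      have hsub : ∀ ω ω', S₁ ω u = S₁ ω' u → u ∈ U ω i → U ω i ⊆ U ω' i :=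
        fun ω ω' hS hu z hz => (k₁ ω ω' _ hS (i, t, u, z) ⟨hu, hz⟩ rfl).1.2
      exact Finset.Subset.antisymm (hsub ω ω' hS he.1)
        (hsub ω' ω hS.symm (hsub ω ω' hS he.1 he.1))
    have hA : (G ω).Adj u w ↔ (G ω').Adj u w :=
      Set.ext_iff.1 (hadj ω ω' u (hd₁ ω ω' u hS)) w
    refine ⟨?_, rfl, ?_⟩
    · simpa only [entries, Set.mem_ofPred_eq, hUi] using he
    · simp only [owner, hUi, hA]
  obtain ⟨J₂, _, S₂, hs₂, hd₂, k₂⟩ := k₂.route hn hE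
    (fun ω v => (ncard_row_le (U ω) v (hD ω v) (hk ω)).trans h₂)
    (fun ω v => (ncard_owner_le hown (U ω) (hβ ω) v).trans h₁)
  refine ⟨J₂, ‹_›, S₂, (hs₁.comp hs₂).mono (le_of_eq (by ring)), hd₂.trans hd₁, ?_⟩
  rintro ω ω' ⟨x, y, i⟩ hS u w hu hw
  have hUi : U ω i = U ω' i := hU ω ω' _ ((hd₂.trans hd₁) ω ω' _ hS)
  have h := (k₂ ω ω' _ hS (i, true, u, w) ⟨hu.1, hw.1⟩ (by
    simp only [owner]
    rw [hu.part_eq, hw.part_eq])).2.2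
  simp only [decide_eq_decide] at h
  simp only [extendedAdjMatrix, Matrix.of_apply, ← hUi, h]

/-- The powers of the adjacency matrices are computed, if the parameters satisfy the bounds that
keep the loads of all vertices at most `L * n` during the distribution of the input, and at most
`L' * n` during the multiplications. -/
theorem Solves.adjMatrixPower (hn : 2 ≤ n) {F : Type} [Field F] [Fintype F]
    {ℓ : Ω → Fin n → Option (Label n r)} (hℓ : ∀ ω, IsLabelling (ℓ ω))
    (hm : gridSize n r ≠ 0) {d q M D k β L L' b : ℕ} [NeZero d] [NeZero q]
    (hD : ∀ ω v, {i | v ∈ U ω i}.ncard ≤ D) (hk : ∀ ω i, (U ω i).card ≤ k) (hkd : k ≤ d * q)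
    (hβ : ∀ ω i x, {u | InPart (U ω i) (gridSize n r) x u}.ncard ≤ β)
    (halg : HasBilinearAlgorithm F d M)
    (h₀ : D * (2 * k) ≤ L * n) (h₁ : 2 * β ^ 2 ≤ L * n) (h₁' : 2 * β ^ 2 ≤ L' * n)
    (h₂ : (q * q / (gridSize n r * gridSize n r) + 1) * (2 * d ^ 2) ≤ L' * n)
    (h₃ : (q * q / (gridSize n r * gridSize n r) + 1) * (2 * M) ≤ L' * n)
    (h₄ : (M / (gridSize n r * gridSize n r) + 1) * (2 * (q * q)) ≤ L' * n)
    (hc₁ : r * (2 * (n * n)) * Fintype.card F ≤ n ^ b)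
    (hc₂ : r * (2 * (q * q * M)) * Fintype.card F ≤ n ^ b) (h : ℕ) :
    Solves (fun ω => localInput (G ω) (U ω) (ℓ ω))
      (fun ω v => requiredOutput F h (G ω) (U ω) (ℓ ω v))
      (3 + 2 * (128 * (L + 5) * (b + 10)) +
        2 * Nat.log 2 h * (4 * (128 * (L' + 5) * (b + 10)))) := by
  classical
  have : NeZero (gridSize n r) := ⟨hm⟩
  have hF : 2 ≤ Fintype.card F := Fintype.one_lt_card
  suffices hsuff : ∀ ℓ₀ : Fin n → Option (Label n r),
      Solves (fun ω : {ω // ℓ ω = ℓ₀} => fun v => (localInput (G ω) (U ω) (ℓ ω) v, ℓ ω))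
        (fun ω v => requiredOutput F h (G ω) (U ω) (ℓ ω v))
        (1 + (2 * (128 * (L + 5) * (b + 10)) +
          2 * Nat.log 2 h * (4 * (128 * (L' + 5) * (b + 10))))) by
    have hlab := Solves.cases (inp := fun ω v => (localInput (G ω) (U ω) (ℓ ω) v, ℓ ω))
      (out := fun ω v => requiredOutput F h (G ω) (U ω) (ℓ ω v)) ℓ
      (fun ω ω' v e => congrArg Prod.snd e) hsuff
    exact ((Solves.exchangeLabels hn ℓ).comp hlab).mono (by omega)
  intro ℓ₀
  by_cases hℓ₀ : IsLabelling ℓ₀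
  swap
  -- No instance has such a table of labels, so the claim is vacuous.
  · refine (Solves.of_determines fun ω => ?_).mono (Nat.zero_le _)
    exact absurd (ω.2 ▸ hℓ ω) hℓ₀
  obtain ⟨own, hown, hown'⟩ := hℓ₀.exists_owner
  let inp : {ω // ℓ ω = ℓ₀} → Fin n → LocalInput n r × (Fin n → Option (Label n r)) :=
    fun ω v => (localInput (G ω) (U ω) (ℓ ω) v, ℓ ω)
  have hmem : Determines inp fun ω v => {i | v ∈ U ω i} := fun ω ω' v e =>
    congrArg LocalInput.memberOf (congrArg Prod.fst e)
  have hadj : Determines inp fun ω v => {w | (G ω).Adj v w} := fun ω ω' v e =>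
    congrArg LocalInput.neighbours (congrArg Prod.fst e)
  obtain ⟨J₁, _, S₁, hs₁, hd₁, hU⟩ := KnowsFamily.exists_of_membership hn hmem hown
  obtain ⟨J₂, _, S₂, hs₂, hd₂, hB⟩ := KnowsBlocks.exists_extendedAdjMatrix
    (Ω := {ω // ℓ ω = ℓ₀}) (U := fun ω => U ω) (G := fun ω => G ω) (b := b) hn F
    (fun ω ω' v e => hadj ω ω' v (hd₁ ω ω' v e)) hown
    hU (fun ω => hD ω) (fun ω => hk ω) (fun ω => hβ ω) h₁ h₀
    ((Nat.mul_le_mul_left _ hF).trans hc₁)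
  obtain ⟨J₃, _, S₃, hs₃, hd₃, hP⟩ : ∃ (J : Type) (_ : Nonempty J)
      (S : {ω // ℓ ω = ℓ₀} → Fin n → J),
      Solves S₂ S (2 * Nat.log 2 h * (4 * (128 * (L' + 5) * (b + 10)))) ∧ Determines S S₂ ∧
        KnowsBlocks (Ω := {ω // ℓ ω = ℓ₀}) own (fun ω => U ω)
          (fun ω i => extendedAdjMatrix F (G ω) (U ω i) ^ h) S := by
    rcases Nat.eq_zero_or_pos h with rfl | hpos
    · refine ⟨J₂, ‹_›, S₂, (Solves.idle S₂ 0).mono (Nat.zero_le _), fun _ _ _ e => e, ?_⟩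
      -- For `h = 0` the matrix is the identity in every instance, so nothing has to be
      -- communicated.
      intro ω ω' L _ u w _ _
      simp only [pow_zero]
    · exact KnowsBlocks.exists_pow hn hown (hU.of_determines hd₂) hB
        (fun ω i => supportedOn_extendedAdjMatrix F _ _) (fun ω i => (hk ω i).trans hkd)
        (fun ω => hβ ω) halg h₁' h₂ h₃ h₄ hc₁ hc₂ h hpos
  refine (((hs₁.comp hs₂).comp hs₃).weaken fun ω ω' v e => ?_).mono (le_of_eq (by ring))
  simp only [ω.2, ω'.2]
  rcases hv : ℓ₀ v with _ | ⟨x, y, i⟩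
  · rfl
  · obtain rfl := (hown' v _).1 hv
    have hUi : U ω i = U ω' i := hU ω ω' _ ((hd₃.trans hd₂) ω ω' _ e)
    exact block_pow_eq hUi (hP ω ω' _ e)

end Input

/-! ### Estimates of the parameters -/

theorem one_le_logb {n : ℕ} (hn : 2 ≤ n) : 1 ≤ Real.logb 2 n := by
  rw [Real.le_logb_iff_rpow_le (by norm_num) (by positivity), Real.rpow_one]
  exact_mod_cast hn

/-- The dimension of the bilinear algorithm which is used on `N` vertices. -/
theorem exists_dimension {σ : ℝ} (hσ : 2 ≤ σ) {N : ℕ} (hN : 0 < N) :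
    ∃ d : ℕ, 0 < d ∧ (d : ℝ) ^ σ ≤ N ∧ d ^ 2 ≤ N ∧ (N : ℝ) ^ (2 / σ) ≤ 4 * (d : ℝ) ^ 2 := by
  have hσ0 : 0 < σ := by linarith
  have hN1 : (1 : ℝ) ≤ N := by exact_mod_cast hN
  set x : ℝ := (N : ℝ) ^ (1 / σ) with hx
  have hx1 : 1 ≤ x := Real.one_le_rpow hN1 (by positivity)
  -- The dimension is `⌊N ^ (1 / σ)⌋`; as `x ≥ 1`, rounding down loses at most a factor two, hence
  -- the factor four after squaring.
  have hd : 0 < ⌊x⌋₊ := Nat.floor_pos.2 hx1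
  have hd1 : (1 : ℝ) ≤ ⌊x⌋₊ := by exact_mod_cast hd
  have hle : (⌊x⌋₊ : ℝ) ≤ x := Nat.floor_le (by linarith)
  have hpow : (⌊x⌋₊ : ℝ) ^ σ ≤ N := by
    calc (⌊x⌋₊ : ℝ) ^ σ ≤ x ^ σ := Real.rpow_le_rpow (by linarith) hle hσ0.le
      _ = N := by
        rw [hx, ← Real.rpow_mul (by linarith), one_div, inv_mul_cancel₀ hσ0.ne', Real.rpow_one]
  refine ⟨⌊x⌋₊, hd, hpow, ?_, ?_⟩
  · have : ((⌊x⌋₊ : ℝ)) ^ 2 ≤ N := by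
      rw [← Real.rpow_two]
      exact (Real.rpow_le_rpow_of_exponent_le hd1 hσ).trans hpow
    exact_mod_cast this
  · have h₁ : x ≤ 2 * ⌊x⌋₊ := by linarith [Nat.lt_floor_add_one x]
    have h₂ : (N : ℝ) ^ (2 / σ) = x ^ 2 := by
      rw [hx, ← Real.rpow_two, ← Real.rpow_mul (by linarith)]
      congr 1
      ring
    rw [h₂]
    nlinarith

namespace BalancedParameters

variable {n r : ℕ} {p a : ℝ}

theorem p_pos (h : BalancedParameters n r p a) (hn : 2 ≤ n) : 0 < p :=
  (Real.rpow_pos_of_pos (by positivity) _).trans_le h.le_p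

theorem one_le_mul_sq (h : BalancedParameters n r p a) (hn : 2 ≤ n) : 1 ≤ (n : ℝ) * p ^ 2 := by
  have hn0 : (0 : ℝ) < n := by positivity
  have h₁ : ((n : ℝ) ^ (-(1 / 2) : ℝ)) ^ 2 = (n : ℝ)⁻¹ := by
    rw [← Real.rpow_natCast, ← Real.rpow_mul hn0.le, ← Real.rpow_neg_one]
    norm_num
  have h₂ := pow_le_pow_left₀ (Real.rpow_nonneg hn0.le _) h.le_p 2
  rw [h₁] at h₂
  calc (1 : ℝ) = n * (n : ℝ)⁻¹ := (mul_inv_cancel₀ hn0.ne').symm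
    _ ≤ _ := by gcongr

theorem one_le_mul (h : BalancedParameters n r p a) (hn : 2 ≤ n) : 1 ≤ (n : ℝ) * p := by
  have := h.one_le_mul_sq hn
  have := h.p_le_one
  have := h.p_pos hn
  have : (n : ℝ) * p ^ 2 ≤ n * p := by
    have h0 : p ^ 2 ≤ p := by nlinarith
    gcongr
  linarith

theorem mul_sq_le_one (h : BalancedParameters n r p a) (hn : 2 ≤ n) : (r : ℝ) * p ^ 2 ≤ 1 := by
  have hp := h.p_pos hn
  rw [h.card_eq, ← Real.rpow_two, ← Real.rpow_add hp]
  exact Real.rpow_le_one hp.le h.p_le_one (by linarith [h.a_le_two])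

theorem one_le_card (h : BalancedParameters n r p a) (hn : 2 ≤ n) : 1 ≤ r := by
  have h₁ : (1 : ℝ) ≤ r := by
    rw [h.card_eq]
    exact Real.one_le_rpow_of_pos_of_le_one_of_nonpos (h.p_pos hn) h.p_le_one
      (by linarith [h.a_nonneg])
  exact_mod_cast h₁

theorem card_le (h : BalancedParameters n r p a) (hn : 2 ≤ n) : r ≤ n := by
  have h₁ := h.mul_sq_le_one hn
  have h₂ := h.one_le_mul_sq hn
  have h₃ : 0 < p ^ 2 := pow_pos (h.p_pos hn) 2
  have h₄ : (r : ℝ) ≤ n := le_of_mul_le_mul_right (h₁.trans h₂) h₃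
  exact_mod_cast h₄

theorem gridSize_pos (h : BalancedParameters n r p a) (hn : 2 ≤ n) : 0 < gridSize n r :=
  Nat.sqrt_pos.2 (Nat.div_pos (h.card_le hn) (h.one_le_card hn))

/-- Since the grid is nonempty, `(gridSize n r + 1)² ≤ 4 (gridSize n r)²`: rounding leaves at least
a quarter as many labels as vertices. -/
theorem le_mul_gridSize (h : BalancedParameters n r p a) (hn : 2 ≤ n) :
    n ≤ 4 * r * (gridSize n r * gridSize n r) := by
  have h₁ : n / r < (gridSize n r + 1) * (gridSize n r + 1) := Nat.lt_succ_sqrt (n / r)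
  have h₂ := Nat.lt_mul_of_div_lt h₁ (h.one_le_card hn)
  have h₃ := h.gridSize_pos hn
  have h₄ : (gridSize n r + 1) * (gridSize n r + 1) ≤ 4 * (gridSize n r * gridSize n r) := by
    nlinarith
  nlinarith [Nat.mul_le_mul_right r h₄]

theorem ceil_le (h : BalancedParameters n r p a) (hn : 2 ≤ n) :
    (⌈4 * (n : ℝ) * p⌉₊ : ℝ) ≤ 5 * (n * p) := by
  have h₁ := h.one_le_mul hn
  have h₂ := Nat.ceil_lt_add_one (a := 4 * (n : ℝ) * p) (by nlinarith)
  linarith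

/-- From `n ≤ 4 r m²` and `r p² ≤ 1` follows `n p² ≤ 4 m²`. With `outerSize_pow_four_le` this makes
every block of size `O(n)`. -/
theorem ceil_sq_le (h : BalancedParameters n r p a) (hn : 2 ≤ n) :
    ⌈4 * (n : ℝ) * p⌉₊ ^ 2 ≤ 100 * n * gridSize n r ^ 2 := by
  have h₁ := pow_le_pow_left₀ (Nat.cast_nonneg _) (h.ceil_le hn) 2
  have h₂ : (n : ℝ) ≤ 4 * r * (gridSize n r * gridSize n r) := by
    exact_mod_cast h.le_mul_gridSize hn
  have h₃ := h.mul_sq_le_one hn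
  have h₄ : (n : ℝ) * p ^ 2 ≤ 4 * (gridSize n r * gridSize n r) := by
    calc (n : ℝ) * p ^ 2 ≤ 4 * r * (gridSize n r * gridSize n r) * p ^ 2 := by gcongr
      _ = 4 * (gridSize n r * gridSize n r) * (r * p ^ 2) := by ring
      _ ≤ 4 * (gridSize n r * gridSize n r) * 1 := by gcongr
      _ = _ := by ring
  have h₅ : ((⌈4 * (n : ℝ) * p⌉₊ : ℝ)) ^ 2 ≤ 100 * n * (gridSize n r : ℝ) ^ 2 := by
    calc _ ≤ (5 * ((n : ℝ) * p)) ^ 2 := h₁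
      _ = 25 * n * (n * p ^ 2) := by ring
      _ ≤ 25 * n * (4 * (gridSize n r * gridSize n r)) := by gcongr
      _ = _ := by ring
  exact_mod_cast h₅

/-- Up to logarithmic and constant factors a vertex handles `(r p + 1) · n p` entries, and `r p² + p
≤ 2`. This yields the additive logarithm in the running time. -/
theorem membership_mul_le (h : BalancedParameters n r p a) (hn : 2 ≤ n) {D : ℕ}
    (hD : (D : ℝ) ≤ (⌈(r : ℝ) * p⌉₊ : ℝ) * 4 * Real.logb 2 n) :
    D * (2 * ⌈4 * (n : ℝ) * p⌉₊) ≤ ⌈80 * Real.logb 2 n⌉₊ * n := by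
  have hp := h.p_pos hn
  have hlog := one_le_logb hn
  have h₁ : (⌈(r : ℝ) * p⌉₊ : ℝ) ≤ r * p + 1 := (Nat.ceil_lt_add_one (by positivity)).le
  have h₂ := h.mul_sq_le_one hn
  have h₃ : (D : ℝ) * (2 * ⌈4 * (n : ℝ) * p⌉₊) ≤ 80 * Real.logb 2 n * n := by
    calc (D : ℝ) * (2 * ⌈4 * (n : ℝ) * p⌉₊)
        ≤ ((r * p + 1) * 4 * Real.logb 2 n) * (2 * (5 * (n * p))) := by
          refine mul_le_mul (hD.trans ?_) (by linarith [h.ceil_le hn]) (by positivity)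
            (by positivity)
          gcongr
      _ = 40 * Real.logb 2 n * n * (r * p ^ 2 + p) := by ring
      _ ≤ 40 * Real.logb 2 n * n * (1 + 1) := by
          gcongr
          exact h.p_le_one
      _ = _ := by ring
  have h₄ : ((D * (2 * ⌈4 * (n : ℝ) * p⌉₊) : ℕ) : ℝ) ≤ ((⌈80 * Real.logb 2 n⌉₊ * n : ℕ) : ℝ) := by
    push_cast
    refine h₃.trans ?_
    gcongr
    exact Nat.le_ceil _
  exact_mod_cast h₄

/-- Here the exponent arises. With `s = 2 / σ = 1 - ρ`, the bounds on `m` and `d` give `(n / r) ^ s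
≤ 16 d²`, while `n p² = n ^ ρ p ^ (2 + a(ρ - 1)) · (n / r) ^ s` holds exactly because `r = p ^
(-a)`. -/
theorem ceil_sq_le_mul_dimension (h : BalancedParameters n r p a) (hn : 2 ≤ n) {σ ρ : ℝ}
    (hσ : 2 ≤ σ) (hρ : ρ = 1 - 2 / σ) {d : ℕ}
    (hd : ((gridSize n r * gridSize n r : ℕ) : ℝ) ^ (2 / σ) ≤ 4 * (d : ℝ) ^ 2) :
    (⌈4 * (n : ℝ) * p⌉₊ : ℝ) ^ 2 ≤
      400 * ((n : ℝ) ^ ρ * p ^ (2 + a * (ρ - 1))) * n * (d : ℝ) ^ 2 := by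
  have hp := h.p_pos hn
  have hn0 : (0 : ℝ) < n := by positivity
  have hσ0 : 0 < σ := by linarith
  set s := 2 / σ with hs
  have hs0 : 0 ≤ s := by positivity
  have hs1 : s ≤ 1 := (div_le_one hσ0).2 hσ
  have hr : (r : ℝ) = p ^ (-a) := h.card_eq
  have hr0 : (0 : ℝ) < r := by rw [hr]; positivity
  have h₁ : (n : ℝ) ≤ 4 * r * (gridSize n r * gridSize n r : ℕ) := by
    exact_mod_cast h.le_mul_gridSize hn
  have h₂ : (n : ℝ) ^ s ≤ 16 * (r : ℝ) ^ s * (d : ℝ) ^ 2 := by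
    calc (n : ℝ) ^ s ≤ (4 * r * (gridSize n r * gridSize n r : ℕ)) ^ s :=
          Real.rpow_le_rpow hn0.le h₁ hs0
      _ = 4 ^ s * (r : ℝ) ^ s * ((gridSize n r * gridSize n r : ℕ) : ℝ) ^ s := by
          rw [Real.mul_rpow (by positivity) (by positivity),
            Real.mul_rpow (by positivity) (by positivity)]
      _ ≤ 4 ^ (1 : ℝ) * (r : ℝ) ^ s * (4 * (d : ℝ) ^ 2) := by
          gcongr
          norm_num
      _ = _ := by rw [Real.rpow_one]; ring
  have h₃ : (n : ℝ) ^ ρ * p ^ (2 + a * (ρ - 1)) * (n ^ s * (r : ℝ) ^ (-s)) = n * p ^ 2 := by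
    have e₁ : (n : ℝ) ^ ρ * n ^ s = n := by
      rw [← Real.rpow_add hn0, hρ, sub_add_cancel, Real.rpow_one]
    have e₂ : p ^ (2 + a * (ρ - 1)) * (r : ℝ) ^ (-s) = p ^ 2 := by
      rw [hr, ← Real.rpow_mul hp.le, ← Real.rpow_add hp, ← Real.rpow_two, hρ]
      congr 1
      ring
    calc _ = ((n : ℝ) ^ ρ * n ^ s) * (p ^ (2 + a * (ρ - 1)) * (r : ℝ) ^ (-s)) := by ring
      _ = _ := by rw [e₁, e₂]
  have h₄ : (n : ℝ) ^ s * (r : ℝ) ^ (-s) ≤ 16 * (d : ℝ) ^ 2 := by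
    rw [Real.rpow_neg hr0.le, ← div_eq_mul_inv, div_le_iff₀ (by positivity)]
    linarith
  calc (⌈4 * (n : ℝ) * p⌉₊ : ℝ) ^ 2 ≤ (5 * ((n : ℝ) * p)) ^ 2 :=
        pow_le_pow_left₀ (Nat.cast_nonneg _) (h.ceil_le hn) 2
    _ = 25 * n * (n * p ^ 2) := by ring
    _ = 25 * n * ((n : ℝ) ^ ρ * p ^ (2 + a * (ρ - 1)) * (n ^ s * (r : ℝ) ^ (-s))) := by rw [h₃]
    _ ≤ 25 * n * ((n : ℝ) ^ ρ * p ^ (2 + a * (ρ - 1)) * (16 * (d : ℝ) ^ 2)) := by gcongr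
    _ = _ := by ring

end BalancedParameters

/-- Message items must have `O(log n)` bits with a constant depending only on `C` and `κ`; the
factor `72 * C' = 2 * 6 * 6 * C'` is absorbed by `n ^ (72 * C')`, as `n ≥ 2`. -/
theorem mul_card_le_pow {n r κ C' q M f : ℕ} (hn : 2 ≤ n) (hr : r ≤ n) (hf : f ≤ n ^ κ)
    (hq : q ≤ 6 * n) (hM : M ≤ C' * n) :
    r * (2 * (n * n)) * f ≤ n ^ (κ + 4 + 72 * C') ∧
      r * (2 * (q * q * M)) * f ≤ n ^ (κ + 4 + 72 * C') := by
  constructor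
  · calc r * (2 * (n * n)) * f ≤ n * (n * (n * n)) * n ^ κ := by gcongr
      _ = n ^ (κ + 4) := by ring
      _ ≤ _ := Nat.pow_le_pow_right (by omega) (Nat.le_add_right _ _)
  · have h₁ : 72 * C' ≤ n ^ (72 * C') :=
      (Nat.lt_two_pow_self).le.trans (Nat.pow_le_pow_left hn _)
    calc r * (2 * (q * q * M)) * f ≤ n * (2 * (6 * n * (6 * n) * (C' * n))) * n ^ κ := by gcongr
      _ = n ^ (κ + 4) * (72 * C') := by ring
      _ ≤ n ^ (κ + 4) * n ^ (72 * C') := Nat.mul_le_mul_left _ h₁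
      _ = _ := (pow_add _ _ _).symm

theorem natLog_le_logb (h : ℕ) : (Nat.log 2 h : ℝ) ≤ Real.logb 2 h := by
  have := Real.natLog_le_logb h 2
  simpa using this

theorem logb_le_mul_logb {n h c : ℕ} (hn : 2 ≤ n) (hh : h ≤ n ^ c) :
    Real.logb 2 h ≤ c * Real.logb 2 n := by
  have hlog := one_le_logb hn
  rcases Nat.eq_zero_or_pos h with rfl | hpos
  · simp only [Nat.cast_zero, Real.logb_zero]
    positivity
  · rw [← Real.logb_pow]
    refine Real.logb_le_logb_of_le (by norm_num) (by exact_mod_cast hpos) ?_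
    exact_mod_cast hh

/-- Each multiplication costs `O(x + 1)` rounds. The `+ 1`, repeated about `z` times, is absorbed by
`y` because `z ≤ c * y`; this is the purpose of the bound on `h`. -/
theorem totalRounds_le {x y z : ℝ} {lh b c C' L L' : ℕ} (hx : 0 ≤ x) (hy : 1 ≤ y) (hz : 0 ≤ z)
    (hzy : z ≤ c * y) (hlh : lh ≤ z) (hL : (L : ℝ) ≤ 80 * y + 3201)
    (hL' : (L' : ℝ) ≤ 2 * (C' + 1) * (800 * x + 4) + 3200) :
    ((3 + 2 * (128 * (L + 5) * (b + 10)) + 2 * lh * (4 * (128 * (L' + 5) * (b + 10))) : ℕ) : ℝ) ≤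
      (3 + 2 * 128 * 3300 * (b + 10) + 1024 * 5000 * (C' + 1) * (b + 10) * (1 + c)) *
        (z * x + y) := by
  have hzx : 0 ≤ z * x := mul_nonneg hz hx
  have h₁ : (L : ℝ) + 5 ≤ 3300 * y := by linarith
  have hC : (0 : ℝ) ≤ C' := Nat.cast_nonneg _
  have h₂ : (L' : ℝ) + 5 ≤ 5000 * (C' + 1) * (x + 1) := by
    have := mul_nonneg hC hx
    nlinarith
  have h₃ : (lh : ℝ) * (x + 1) ≤ (1 + c) * (z * x + y) := by
    have e₁ : (lh : ℝ) * (x + 1) ≤ z * (x + 1) := by gcongr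
    have e₂ : 0 ≤ (c : ℝ) * (z * x) := by positivity
    nlinarith
  push_cast
  calc (3 : ℝ) + 2 * (128 * (L + 5) * (b + 10)) + 2 * lh * (4 * (128 * (L' + 5) * (b + 10)))
      ≤ 3 * (z * x + y) + 2 * (128 * (3300 * (z * x + y)) * (b + 10)) +
        2 * lh * (4 * (128 * (5000 * (C' + 1) * (x + 1)) * (b + 10))) := by
        gcongr
        · linarith
        · linarith
    _ = 3 * (z * x + y) + 2 * 128 * 3300 * (b + 10) * (z * x + y) +
        1024 * 5000 * (C' + 1) * (b + 10) * (lh * (x + 1)) := by ring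
    _ ≤ 3 * (z * x + y) + 2 * 128 * 3300 * (b + 10) * (z * x + y) +
        1024 * 5000 * (C' + 1) * (b + 10) * ((1 + c) * (z * x + y)) := by gcongr
    _ = _ := by ring

theorem ncard_inPart_le_sqrt {n r : ℕ} {p a : ℝ} (hn : 2 ≤ n) (hp : BalancedParameters n r p a)
    {W : Finset (Fin n)} (hW : W.card ≤ ⌈4 * (n : ℝ) * p⌉₊) (x : ℕ) :
    {u | InPart W (gridSize n r) x u}.ncard ≤ Nat.sqrt (1600 * n) := by
  have hm := hp.gridSize_pos hn
  refine (ncard_inPart_le hm W x).trans (Nat.le_sqrt.2 ?_)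
  have h₁ := outerSize_pow_four_le (n := n) (B := 100) hm (by norm_num) (by omega)
    ((Nat.pow_le_pow_left hW 2).trans (hp.ceil_sq_le hn))
  calc _ = outerSize W.card (gridSize n r) ^ 4 := by ring
    _ ≤ _ := h₁

/-! ### Choice of the parameters and the final bound. -/

theorem mainTheorem7 (C σ : ℝ) (hσ : 2 ≤ σ) (κ c : ℕ) :
    ∃ K : ℝ, ∀ (n r h : ℕ) (p a ρ : ℝ) (F : Type) [Field F] [Fintype F],
      2 ≤ n → BalancedParameters n r p a → h ≤ n ^ c →
      Fintype.card F ≤ n ^ κ → HasMultiplicationExponent F C σ → ρ = 1 - 2 / σ →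
      ∃ (T : ℕ) (alg : CongestedClique n (LocalInput n r) (Fin n → Fin n → Option F)),
        (T : ℝ) ≤ K * (Real.logb 2 h * (n : ℝ) ^ ρ * p ^ (2 + a * (ρ - 1)) + Real.logb 2 n) ∧
        ∀ (G : Digraph (Fin n)) (U : Fin r → Finset (Fin n)) (ℓ : Fin n → Option (Label n r)),
          IsBalanced p a U → IsLabelling ℓ →
          ∀ (v : Fin n) (x y : Fin (gridSize n r)) (i : Fin r), ℓ v = some (x, y, i) →
            alg.output (localInput G U ℓ) T v =
              block (inducedAdjMatrix F G (U i) ^ h) (gridSize n r) x y := by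
  classical
  refine ⟨3 + 2 * 128 * 3300 * ((κ + 4 + 72 * ⌈C⌉₊ : ℕ) + 10) +
    1024 * 5000 * (⌈C⌉₊ + 1) * ((κ + 4 + 72 * ⌈C⌉₊ : ℕ) + 10) * (1 + c), ?_⟩
  intro n r h p a ρ F _ _ hn hp hh hF hexp hρ
  set m := gridSize n r with hm
  have hm0 : 0 < m := hp.gridSize_pos hn
  have hN0 : 0 < m * m := Nat.mul_pos hm0 hm0
  have hr1 := hp.one_le_card hn
  have hNn : m * m ≤ n := (Nat.le_mul_of_pos_right _ hr1).trans (gridSize_mul_le n r)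
  have hp0 := hp.p_pos hn
  obtain ⟨d, hd0, hdσ, hd2, hd4⟩ := exists_dimension hσ hN0
  obtain ⟨M, hM, halg⟩ := hexp d hd0
  have : NeZero d := ⟨hd0.ne'⟩
  set k := ⌈4 * (n : ℝ) * p⌉₊ with hk
  set X : ℝ := (n : ℝ) ^ ρ * p ^ (2 + a * (ρ - 1)) with hX
  have hX0 : 0 ≤ X := by positivity
  set q := k / d + 1 with hq
  have hMN : M ≤ ⌈C⌉₊ * (m * m) := by
    have : (M : ℝ) ≤ ((⌈C⌉₊ * (m * m) : ℕ) : ℝ) := by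
      rw [Nat.cast_mul]
      exact hM.trans (mul_le_mul (Nat.le_ceil C) hdσ (by positivity) (Nat.cast_nonneg _))
    exact_mod_cast this
  have hkn : k ≤ 5 * n := by
    have h₁ : (k : ℝ) ≤ ((5 * n : ℕ) : ℝ) := by
      push_cast
      refine (hp.ceil_le hn).trans ?_
      have := mul_le_mul_of_nonneg_left hp.p_le_one (Nat.cast_nonneg (α := ℝ) n)
      linarith
    exact_mod_cast h₁
  have hkd : k ≤ d * q := by
    have := Nat.lt_mul_div_succ k hd0
    exact this.le
  have hq6 : q ≤ 6 * n := by
    have := Nat.div_le_self k d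
    omega
  -- From `q ≤ k / d + 1` follows `q² ≤ 2 (k / d)² + 2 ≤ 800 X n + 2`, which is at most `Q n`.
  set Q := ⌈800 * X⌉₊ + 2 with hQ
  have hqQ : q * q ≤ Q * n := by
    have hd0' : (0 : ℝ) < d := by exact_mod_cast hd0
    have h₁ : (q : ℝ) ≤ k / d + 1 := by
      rw [hq, Nat.cast_add, Nat.cast_one]
      gcongr
      exact Nat.cast_div_le
    have h₂ : ((k : ℝ) / d) ^ 2 ≤ 400 * X * n := by
      rw [div_pow, div_le_iff₀ (by positivity)]
      exact hp.ceil_sq_le_mul_dimension hn hσ hρ hd4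
    have h₃ : (q : ℝ) * q ≤ 800 * X * n + 2 := by
      have h₄ : (q : ℝ) * q ≤ (k / d + 1) * (k / d + 1) :=
        mul_self_le_mul_self (Nat.cast_nonneg _) h₁
      nlinarith [sq_nonneg ((k : ℝ) / d - 1)]
    have h₅ : ((q * q : ℕ) : ℝ) ≤ ((Q * n : ℕ) : ℝ) := by
      push_cast [hQ]
      have h₆ : 800 * X * n ≤ ⌈800 * X⌉₊ * (n : ℝ) := by
        gcongr
        exact Nat.le_ceil _
      have h₇ : (2 : ℝ) ≤ n := by exact_mod_cast hn
      nlinarith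
    exact_mod_cast h₅
  -- The summand `3200` in `L` and `L'` pays for a block, as `2 * β ^ 2 ≤ 3200 * n`; the remaining
  -- summands pay for the input rows and for the products.
  set L := ⌈80 * Real.logb 2 n⌉₊ + 3200 with hL
  set L' := 2 * (⌈C⌉₊ + 1) * (Q + 1) + 3200 with hL'
  set β := Nat.sqrt (1600 * n) with hβ
  have hβ2 : 2 * β ^ 2 ≤ 3200 * n := by
    have := Nat.sqrt_le' (1600 * n)
    simp only [hβ]
    omega
  have hdiv : ∀ Y, (Y / (m * m) + 1) * (m * m) ≤ Y + m * m := fun Y => by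
    rw [Nat.add_mul, Nat.one_mul]
    exact Nat.add_le_add_right (Nat.div_mul_le_self _ _) _
  have hqN : (q * q / (m * m) + 1) * (m * m) ≤ (Q + 1) * n := by
    exact (hdiv _).trans ((Nat.add_le_add hqQ hNn).trans (le_of_eq (by ring)))
  have hL'n : 2 * (⌈C⌉₊ + 1) * ((Q + 1) * n) ≤ L' * n := by
    rw [← mul_assoc]
    exact Nat.mul_le_mul_right _ (Nat.le_add_right _ _)
  have h₂ : (q * q / (m * m) + 1) * (2 * d ^ 2) ≤ L' * n := by
    calc (q * q / (m * m) + 1) * (2 * d ^ 2) ≤ (q * q / (m * m) + 1) * (2 * (m * m)) := by gcongr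
      _ = 2 * 1 * ((q * q / (m * m) + 1) * (m * m)) := by ring
      _ ≤ 2 * (⌈C⌉₊ + 1) * ((Q + 1) * n) := by
        gcongr
        exact Nat.le_add_left 1 _
      _ ≤ _ := hL'n
  have h₃ : (q * q / (m * m) + 1) * (2 * M) ≤ L' * n := by
    calc (q * q / (m * m) + 1) * (2 * M) ≤ (q * q / (m * m) + 1) * (2 * (⌈C⌉₊ * (m * m))) := by
          gcongr
      _ = 2 * ⌈C⌉₊ * ((q * q / (m * m) + 1) * (m * m)) := by ring
      _ ≤ 2 * (⌈C⌉₊ + 1) * ((Q + 1) * n) := by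
        gcongr
        exact Nat.le_succ _
      _ ≤ _ := hL'n
  have h₄ : (M / (m * m) + 1) * (2 * (q * q)) ≤ L' * n := by
    calc (M / (m * m) + 1) * (2 * (q * q)) ≤ (⌈C⌉₊ + 1) * (2 * (Q * n)) := by
          gcongr
          exact Nat.div_le_of_le_mul (hMN.trans (le_of_eq (mul_comm _ _)))
      _ = 2 * (⌈C⌉₊ + 1) * (Q * n) := by ring
      _ ≤ 2 * (⌈C⌉₊ + 1) * ((Q + 1) * n) := by
        gcongr
        exact Nat.le_succ _
      _ ≤ _ := hL'n
  obtain ⟨hc₁, hc₂⟩ := mul_card_le_pow (κ := κ) (C' := ⌈C⌉₊) hn (hp.card_le hn) hF hq6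
    (hMN.trans (Nat.mul_le_mul_left _ hNn))
  set D := ⌊(⌈(r : ℝ) * p⌉₊ : ℝ) * 4 * Real.logb 2 n⌋₊ with hD
  have hlog := one_le_logb hn
  have hDle : (D : ℝ) ≤ (⌈(r : ℝ) * p⌉₊ : ℝ) * 4 * Real.logb 2 n := Nat.floor_le (by positivity)
  -- The instances range over all graphs, balanced families and labellings with the parameters
  -- fixed, so one algorithm serves all of them.
  let Ω := {ω : Digraph (Fin n) × (Fin r → Finset (Fin n)) × (Fin n → Option (Label n r)) //
    IsBalanced p a ω.2.1 ∧ IsLabelling ω.2.2}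
  have hsolve := Solves.adjMatrixPower (Ω := Ω) (G := fun ω => ω.1.1) (U := fun ω => ω.1.2.1)
    (ℓ := fun ω => ω.1.2.2) (F := F) (d := d) (q := q) (M := M) (D := D) (k := k) (β := β) (L := L)
    (L' := L') (b := κ + 4 + 72 * ⌈C⌉₊) hn (fun ω => ω.2.2) hm0.ne' ?_
    (fun ω i => ω.2.1.card_le i) hkd (fun ω i => ncard_inPart_le_sqrt hn hp (ω.2.1.card_le i)) halg
    ?_ ?_ ?_ h₂ h₃ h₄ hc₁ hc₂ h
  · obtain ⟨alg, halg⟩ := hsolve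
    refine ⟨3 + 2 * (128 * (L + 5) * (κ + 4 + 72 * ⌈C⌉₊ + 10)) +
      2 * Nat.log 2 h * (4 * (128 * (L' + 5) * (κ + 4 + 72 * ⌈C⌉₊ + 10))), alg, ?_, fun G U ℓ hU hℓ v x y i hv => ?_⟩
    · rw [mul_assoc (Real.logb 2 h)]
      refine totalRounds_le (C' := ⌈C⌉₊) hX0 hlog ((Nat.cast_nonneg _).trans (natLog_le_logb h))
        (logb_le_mul_logb hn hh) (natLog_le_logb h) ?_ ?_
      · rw [hL]
        push_cast
        have := Nat.ceil_lt_add_one (a := 80 * Real.logb 2 n) (by positivity)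
        linarith
      · rw [hL', hQ]
        push_cast
        have := Nat.ceil_lt_add_one (a := 800 * X) (by positivity)
        have e : (⌈800 * X⌉₊ : ℝ) + 2 + 1 ≤ 800 * X + 4 := by linarith
        have := mul_le_mul_of_nonneg_left e (by positivity : (0 : ℝ) ≤ 2 * (⌈C⌉₊ + 1))
        linarith
    · have := halg ⟨(G, U, ℓ), hU, hℓ⟩ v
      simp only [hv] at this
      exact this
  · intro ω v
    refine Nat.le_floor ?_
    have h₁ := ω.2.1.membership_le v
    rwa [Set.ncard_eq_toFinset_card', Set.toFinset_ofPred]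
  · refine (hp.membership_mul_le hn hDle).trans (Nat.mul_le_mul_right _ ?_)
    exact Nat.le_add_right _ _
  · exact hβ2.trans (Nat.mul_le_mul_right _ (Nat.le_add_left _ _))
  · exact hβ2.trans (Nat.mul_le_mul_right _ (Nat.le_add_left _ _))
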